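/- **Theorem 3.10 (Global error).** Let $\mathsf H_1,\mathsf H_0$ be complex Hilbert spaces with $\mathsf H_1$ continuously embedded in $\mathsf H_0$. Let $A$ be a self-adjoint operator in $\mathsf H_1$, with unitary group $\Phi^A(t)=e^{-itA}$, that has a self-adjoint extension $A:D\to\mathsf H_0$ with $\mathsf H_1\subseteq D\subseteq\mathsf H_0$. Let $B:\mathsf H_1\to\mathsf H_1$ be locally Lipschitz, and assume that there is a map $B':\mathsf H_1\to\mathcal B(\mathsf H_0)$ (bounded real-linear operators) such that for all $R,\varepsilon>0$ there are $C,\delta>0$ with $$\|B'(u)\|_{\mathcal B(\mathsf H_0)}\le C,\qquad \|B(u+w)-B(u)-B'(u)w\|_{\mathsf H_0}\le\varepsilon\|w\|_{\mathsf H_0}$$ for all $u,w\in\mathsf H_1$ with $\|u\|_{\mathsf H_1}\le R$ and $\|w\|_{\mathsf H_1}<\delta$. For $u_0\in\mathsf H_1$ let $\Phi(t)u_0=u(t)$, $0\le t<T^*(u_0)$, be the maximal solution, continuous with values in $\mathsf H_1$, of $$u(t)=\Phi^A(t)u_0-i\int_0^t\Phi^A(t-s)B(u(s))\,ds .$$ Let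 $0<T<T^*(u_0)$, and let $\alpha,\beta:\mathbb R\to\mathbb R$ be locally integrable, bounded, $T$-periodic functions with mean value $\frac1T\int_0^T\alpha=\frac1T\int_0^T\beta=1$. For $n\ge1$ put $h_n=T/n$, $\alpha_n(t)=\alpha(nt)$, $\beta_n(t)=\beta(nt)$, and let $\Phi_n(t)u_0=u_n(t)$ be the solution, continuous with values in $\mathsf H_1$, of $$u_n(t)=\Phi^A\Big(\int_0^t\alpha_n\Big)u_0-i\int_0^t\beta_n(s)\,\Phi^A\Big(\int_s^t\alpha_n\Big)B(u_n(s))\,ds .$$ Then there are a constant $C>0$ and $n_0\in\mathbb N$ such that for all $n\ge n_0$ the solution $\Phi_n(t)u_0$ is defined for $t\in[0,T]$ and $$\max_{0\le k\le n}\|\Phi(kh_n)u_0-\Phi_n(kh_n)u_0\|_{\mathsf H_0}\le C\,h_n .$$ -/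

import Mathlib

open MeasureTheory Set

namespace AbstractSplitting

section Group

variable {H : Type*} [NormedAddCommGroup H] [InnerProductSpace ℂ H]

/-- `U` is a strongly continuous one-parameter group of unitary operators on `H` whose
infinitesimal generator is exactly `-iA` (equality of the domains included). -/
structure IsUnitaryGroupOf (A : H →ₗ.[ℂ] H) (U : ℝ → H ≃ₗᵢ[ℂ] H) : Prop where
  map_zero : ∀ x : H, U 0 x = x
  map_add : ∀ (s t : ℝ) (x : H), U (s + t) x = U s (U t x)
  continuous : ∀ x : H, Continuous fun t : ℝ => U t x
  generator : ∀ x y : H, HasDerivAt (fun t : ℝ => U t x) y 0 ↔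
    ∃ hx : x ∈ A.domain, y = -(Complex.I • A ⟨x, hx⟩)

open Classical in
/-- The unitary group `Φ^A` generated by `-iA`. By Stone's theorem it exists, and it is unique,
whenever `A` is self-adjoint; for operators that generate no unitary group the value is
the trivial group. -/
noncomputable def unitaryGroup (A : H →ₗ.[ℂ] H) : ℝ → H ≃ₗᵢ[ℂ] H :=
  if h : ∃ U : ℝ → H ≃ₗᵢ[ℂ] H, IsUnitaryGroupOf A U then h.choose
  else fun _ => LinearIsometryEquiv.refl ℂ H

/-- The propagator `Φ^{A,a}(t₁,t₀) = Φ^A(∫_{t₀}^{t₁} a)` of the linear equation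
`u_t = -i a(t) A u`. -/
noncomputable def propagator (A : H →ₗ.[ℂ] H) (a : ℝ → ℝ) (t₁ t₀ : ℝ) : H ≃ₗᵢ[ℂ] H :=
  unitaryGroup A (∫ s in t₀..t₁, a s)

/-- `u` is a continuous solution on `[0,T]` of Duhamel's equation for
`u_t + iAu + iB(u) = 0`, `u(0) = u₀`. -/
def IsMildSolution (A : H →ₗ.[ℂ] H) (B : H → H) (u₀ : H) (T : ℝ) (u : ℝ → H) : Prop :=
  ContinuousOn u (Icc 0 T) ∧
    ∀ t ∈ Icc (0 : ℝ) T, u t = unitaryGroup A t u₀ -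
      Complex.I • ∫ s in (0 : ℝ)..t, unitaryGroup A (t - s) (B (u s))

/-- `u` is a continuous solution on `[0,T]` of the generalized Duhamel equation for
the non-autonomous problem `u_t + i(a(t)A + b(t)B)u = 0`, `u(0) = u₀`. -/
def IsSplitSolution (A : H →ₗ.[ℂ] H) (B : H → H) (a b : ℝ → ℝ) (u₀ : H) (T : ℝ)
    (u : ℝ → H) : Prop :=
  ContinuousOn u (Icc 0 T) ∧
    ∀ t ∈ Icc (0 : ℝ) T, u t = propagator A a t 0 u₀ -
      Complex.I • ∫ s in (0 : ℝ)..t, b s • propagator A a t s (B (u s))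

/-- The maximal existence time `T*(u₀) ∈ [0,∞]`: the supremum of all `T` such that the
exact problem has a solution on `[0,T]`. -/
noncomputable def maximalTime (A : H →ₗ.[ℂ] H) (B : H → H) (u₀ : H) : ENNReal :=
  sSup {τ | ∃ T : ℝ, 0 ≤ T ∧ τ = ENNReal.ofReal T ∧ ∃ u : ℝ → H, IsMildSolution A B u₀ T u}

open Classical in
/-- The exact flow `Φ(t)u₀ = u(t)`, where `u` is the solution on `[0,t]` of the exact problem
(and the value `0` where there is no solution up to time `t`). -/
noncomputable def exactFlow (A : H →ₗ.[ℂ] H) (B : H → H) (t : ℝ) (u₀ : H) : H :=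
  if h : ∃ u : ℝ → H, IsMildSolution A B u₀ t u then h.choose t else 0

open Classical in
/-- The flow from time `0` to time `t` of the non-autonomous problem with coefficients `a`, `b`
(and the value `0` where there is no solution up to time `t`). -/
noncomputable def splitFlow (A : H →ₗ.[ℂ] H) (B : H → H) (a b : ℝ → ℝ) (t : ℝ) (u₀ : H) : H :=
  if h : ∃ u : ℝ → H, IsSplitSolution A B a b u₀ t u then h.choose t else 0

end Group

/-- The admissible coefficients of an abstract time-splitting method on `[0,T]`: real, locally
integrable, (essentially) bounded, `T`-periodic, with mean value `1` over a period. -/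
structure IsSplittingCoefficient (T : ℝ) (α : ℝ → ℝ) : Prop where
  locallyIntegrable : LocallyIntegrable α volume
  bounded : ∃ M : ℝ, ∀ᵐ t ∂(volume : Measure ℝ), |α t| ≤ M
  periodic : Function.Periodic α T
  mean : (∫ t in (0 : ℝ)..T, α t) / T = 1

/-- The condition on the nonlinearity `B` in terms of `B' : H₁ → 𝓑(H₀)`, uniform on bounded
subsets of `H₁`; `J` is the embedding of `H₁` in `H₀`. The operators `B'(u)` are bounded and
real-linear, as for `B(u) = |u|²u`; complex-linear ones are a special case. -/
def HasUniformDerivative {H₁ H₀ : Type*} [NormedAddCommGroup H₁] [InnerProductSpace ℂ H₁]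
    [NormedAddCommGroup H₀] [InnerProductSpace ℂ H₀] (J : H₁ →L[ℂ] H₀) (B : H₁ → H₁)
    (B' : H₁ → H₀ →L[ℝ] H₀) : Prop :=
  ∀ R > (0 : ℝ), ∀ ε > (0 : ℝ), ∃ C > (0 : ℝ), ∃ δ > (0 : ℝ), ∀ u w : H₁,
    ‖u‖ ≤ R → ‖w‖ < δ →
      ‖B' u‖ ≤ C ∧ ‖J (B (u + w)) - J (B u) - B' u (J w)‖ ≤ ε * ‖J w‖

end AbstractSplitting

/-!
In the interaction picture `w t = U (-∫₀ᵗ a) (u t)`, with `U` the unitary group of `A`, the exact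
equation becomes `w' = F(t, w)` and the splitting equation `w' = b(t) F(∫₀ᵗ a, w)`, where
`F(τ, x) = -i U (-τ) (B (U τ x))`. So one has to average `h`-periodic coefficients `a` and `b` of
mean one, for which `∫₀ᵗ a = t + O(h)`. In `H₁` the field `F` is merely continuous in `τ`: replacing
`b(s) F(∫₀ˢ a, ·)` by `F(s, ·)` along the exact solution changes the time integrals by `o(1)`, which
by a fixed point argument in a tube around that solution yields a splitting solution up to time `T`.
In the norm of `H₀` the field is Lipschitz in both variables, because `H₁` lies in the domain of the
extension of `A`. There the change is `O(h)`, and Grönwall's inequality turns it into the error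
bound.
-/

namespace AbstractSplitting

open Filter Metric Topology
open scoped NNReal

section UnitaryGroup

variable {H : Type*} [NormedAddCommGroup H] [InnerProductSpace ℂ H]

/-- A strongly continuous one-parameter group of unitary operators, without reference to its
generator. -/
structure IsContinuousUnitaryGroup (U : ℝ → H ≃ₗᵢ[ℂ] H) : Prop where
  map_zero : ∀ x : H, U 0 x = x
  map_add : ∀ (s t : ℝ) (x : H), U (s + t) x = U s (U t x)
  continuous : ∀ x : H, Continuous fun t : ℝ => U t x

theorem isContinuousUnitaryGroup_unitaryGroup (A : H →ₗ.[ℂ] H) :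
    IsContinuousUnitaryGroup (unitaryGroup A) := by
  unfold unitaryGroup
  split_ifs with h
  · exact ⟨h.choose_spec.map_zero, h.choose_spec.map_add, h.choose_spec.continuous⟩
  · exact ⟨fun _ => rfl, fun _ _ _ => rfl, fun _ => continuous_const⟩

namespace IsContinuousUnitaryGroup

variable {U : ℝ → H ≃ₗᵢ[ℂ] H}

theorem apply_neg_apply (hU : IsContinuousUnitaryGroup U) (t : ℝ) (x : H) :
    U t (U (-t) x) = x := by
  rw [← hU.map_add, add_neg_cancel, hU.map_zero]

theorem neg_apply_apply (hU : IsContinuousUnitaryGroup U) (t : ℝ) (x : H) :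
    U (-t) (U t x) = x := by
  rw [← hU.map_add, neg_add_cancel, hU.map_zero]

theorem continuous_uncurry (hU : IsContinuousUnitaryGroup U) :
    Continuous fun p : ℝ × H => U p.1 p.2 := by
  rw [continuous_iff_continuousAt]
  rintro ⟨t₀, x₀⟩
  have hbound (p : ℝ × H) : dist (U p.1 p.2) (U t₀ x₀) ≤ dist p.2 x₀ + dist (U p.1 x₀) (U t₀ x₀) :=
    (dist_triangle _ (U p.1 x₀) _).trans_eq (by rw [LinearIsometryEquiv.dist_map])
  have hlim : Tendsto (fun p : ℝ × H => dist p.2 x₀ + dist (U p.1 x₀) (U t₀ x₀))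
      (𝓝 (t₀, x₀)) (𝓝 0) := by
    have : Continuous fun p : ℝ × H => dist p.2 x₀ + dist (U p.1 x₀) (U t₀ x₀) :=
      (continuous_snd.dist continuous_const).add
        (((hU.continuous x₀).comp continuous_fst).dist continuous_const)
    simpa using this.tendsto (t₀, x₀)
  exact tendsto_iff_dist_tendsto_zero.2 (squeeze_zero (fun _ => dist_nonneg) hbound hlim)

theorem continuousOn_apply (hU : IsContinuousUnitaryGroup U) {X : Type*} [TopologicalSpace X]
    {s : Set X} {φ : X → ℝ} {u : X → H} (hφ : ContinuousOn φ s) (hu : ContinuousOn u s) :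
    ContinuousOn (fun x => U (φ x) (u x)) s :=
  hU.continuous_uncurry.comp_continuousOn (hφ.prodMk hu)

end IsContinuousUnitaryGroup

theorem IsUnitaryGroupOf.exists_hasDerivAt {A : H →ₗ.[ℂ] H} {U : ℝ → H ≃ₗᵢ[ℂ] H}
    (h : IsUnitaryGroupOf A U) (x : A.domain) (t : ℝ) :
    ∃ hx : U t x ∈ A.domain,
      HasDerivAt (fun s : ℝ => U s x) (-(Complex.I • A ⟨U t x, hx⟩)) t := by
  set y := U t (-(Complex.I • A x))
  have hderiv_zero : HasDerivAt (fun s : ℝ => U s (U t x)) y 0 := by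
    have hx : HasDerivAt (fun s : ℝ => U s x) (-(Complex.I • A x)) 0 :=
      (h.generator _ _).2 ⟨x.2, rfl⟩
    have hUx : HasDerivAt (fun s : ℝ => U t (U s x)) y 0 :=
      ((U t : H →L[ℂ] H).restrictScalars ℝ).hasFDerivAt.comp_hasDerivAt 0 hx
    convert hUx using 2 with s
    rw [← h.map_add, ← h.map_add, add_comm]
  obtain ⟨hmem, hy⟩ := (h.generator _ _).1 hderiv_zero
  refine ⟨hmem, ?_⟩
  rw [← hy]
  have hshift : HasDerivAt (fun s : ℝ => U (s - t) (U t x)) y t :=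
    HasDerivAt.comp_sub_const t t (by rwa [sub_self])
  convert hshift using 2 with s
  rw [← h.map_add, sub_add_cancel]

end UnitaryGroup

section Embedding

variable {H₁ H₀ : Type*} [NormedAddCommGroup H₁] [InnerProductSpace ℂ H₁]
  [NormedAddCommGroup H₀] [InnerProductSpace ℂ H₀]

/-- The group `U` on `H₁`, measured through `J` in the weaker norm of `H₀`, is still isometric, and
its orbits are Lipschitz in time with constant proportional to the `H₁`-norm. This is all that the
error estimate uses of the extension of `A` to `H₀`. -/
structure IsWeaklyLipschitzGroup (J : H₁ →L[ℂ] H₀) (U : ℝ → H₁ ≃ₗᵢ[ℂ] H₁) (K : ℝ≥0) : Prop where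
  norm_map : ∀ (t : ℝ) (x : H₁), ‖J (U t x)‖ = ‖J x‖
  norm_map_sub_le : ∀ (s t : ℝ) (x : H₁), ‖J (U t x) - J (U s x)‖ ≤ K * |t - s| * ‖x‖

theorem isFormalAdjoint_self_of_isSelfAdjoint [CompleteSpace H₀] {A : H₀ →ₗ.[ℂ] H₀}
    (hA : IsSelfAdjoint A) : A.IsFormalAdjoint A := by
  have h := LinearPMap.adjoint_isFormalAdjoint hA.dense_domain
  rwa [LinearPMap.isSelfAdjoint_def.1 hA] at h

/-- A variant of the Hellinger–Toeplitz theorem. -/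
theorem exists_norm_apply_le_of_isFormalAdjoint_self [CompleteSpace H₁] [CompleteSpace H₀]
    (J : H₁ →L[ℂ] H₀) {A₀ : H₀ →ₗ.[ℂ] H₀} (hdense : Dense (A₀.domain : Set H₀))
    (hsymm : A₀.IsFormalAdjoint A₀) (hdom : ∀ x : H₁, J x ∈ A₀.domain) :
    ∃ K : ℝ≥0, ∀ x : H₁, ‖A₀ ⟨J x, hdom x⟩‖ ≤ K * ‖x‖ := by
  let L : H₁ →ₗ[ℂ] H₀ := A₀.toFun ∘ₗ J.toLinearMap.codRestrict A₀.domain hdom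
  have hinner (x : H₁) (z : A₀.domain) : inner ℂ (L x) (z : H₀) = inner ℂ (J x) (A₀ z) :=
    hsymm ⟨J x, hdom x⟩ z
  have hcont : Continuous L := by
    refine L.continuous_of_seq_closed_graph fun u x y hu hy => ?_
    refine hdense.eq_of_inner_left ℂ fun z hz => ?_
    have hlim : Tendsto (fun n => inner ℂ (L (u n)) z) atTop (𝓝 (inner ℂ (L x) z)) := by
      simp only [hinner _ ⟨z, hz⟩]
      exact ((J.continuous.tendsto x).comp hu).inner tendsto_const_nhds
    exact tendsto_nhds_unique (hy.inner tendsto_const_nhds) hlim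
  let L' : H₁ →L[ℂ] H₀ := ⟨L, hcont⟩
  exact ⟨‖L'‖₊, fun x => L'.le_opNorm x⟩

theorem IsUnitaryGroupOf.hasDerivAt_map {A : H₁ →ₗ.[ℂ] H₁} {U : ℝ → H₁ ≃ₗᵢ[ℂ] H₁}
    (h : IsUnitaryGroupOf A U) {J : H₁ →L[ℂ] H₀} {A₀ : H₀ →ₗ.[ℂ] H₀}
    {hdom : ∀ x : H₁, J x ∈ A₀.domain}
    (hext : ∀ x : A.domain, A₀ ⟨J (x : H₁), hdom x⟩ = J (A x)) (x : A.domain) (t : ℝ) :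
    HasDerivAt (fun s : ℝ => J (U s x)) (-(Complex.I • A₀ ⟨J (U t x), hdom _⟩)) t := by
  obtain ⟨hx, hderiv⟩ := h.exists_hasDerivAt x t
  have hJ := (J.restrictScalars ℝ).hasFDerivAt.comp_hasDerivAt t hderiv
  rw [hext ⟨U t x, hx⟩]
  simpa [Function.comp_def] using hJ

theorem norm_eq_of_hasDerivAt_neg_I_smul {A₀ : H₀ →ₗ.[ℂ] H₀} (hsymm : A₀.IsFormalAdjoint A₀)
    {y : ℝ → A₀.domain} (hy : ∀ t, HasDerivAt (fun s => (y s : H₀)) (-(Complex.I • A₀ (y t))) t)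
    (s t : ℝ) : ‖(y s : H₀)‖ = ‖(y t : H₀)‖ := by
  have him (r : ℝ) : (inner ℂ (y r : H₀) (A₀ (y r))).im = 0 := by
    rw [← Complex.conj_eq_iff_im, inner_conj_symm]
    exact hsymm (y r) (y r)
  have hsq (r : ℝ) : HasDerivAt (fun r => ‖(y r : H₀)‖ ^ 2) 0 r := by
    let : InnerProductSpace ℝ H₀ := InnerProductSpace.rclikeToReal ℂ H₀
    convert (hy r).norm_sq using 1
    rw [real_inner_eq_re_inner ℂ]
    simp [inner_neg_right, inner_smul_right, him]
  refine (sq_eq_sq₀ (norm_nonneg _) (norm_nonneg _)).1 ?_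
  exact is_const_of_deriv_eq_zero (fun r => (hsq r).differentiableAt) (fun r => (hsq r).deriv) s t

theorem IsUnitaryGroupOf.exists_isWeaklyLipschitzGroup [CompleteSpace H₁] [CompleteSpace H₀]
    {A : H₁ →ₗ.[ℂ] H₁} {U : ℝ → H₁ ≃ₗᵢ[ℂ] H₁} (h : IsUnitaryGroupOf A U)
    (hA : Dense (A.domain : Set H₁)) {J : H₁ →L[ℂ] H₀} {A₀ : H₀ →ₗ.[ℂ] H₀}
    (hdense : Dense (A₀.domain : Set H₀)) (hsymm : A₀.IsFormalAdjoint A₀)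
    {hdom : ∀ x : H₁, J x ∈ A₀.domain}
    (hext : ∀ x : A.domain, A₀ ⟨J (x : H₁), hdom x⟩ = J (A x)) :
    ∃ K : ℝ≥0, IsWeaklyLipschitzGroup J U K := by
  obtain ⟨K, hK⟩ := exists_norm_apply_le_of_isFormalAdjoint_self J hdense hsymm hdom
  have hJU (t : ℝ) : Continuous fun x => J (U t x) := J.continuous.comp (U t).continuous
  refine ⟨K, fun t => hA.induction (fun x hx => ?_) ?_, fun s t => hA.induction (fun x hx => ?_) ?_⟩
  · have := norm_eq_of_hasDerivAt_neg_I_smul hsymm (y := fun s => ⟨J (U s x), hdom _⟩)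
      (h.hasDerivAt_map hext ⟨x, hx⟩) t 0
    simpa only [h.map_zero] using this
  · exact isClosed_eq (hJU t).norm J.continuous.norm
  · have hbound (r : ℝ) : ‖-(Complex.I • A₀ ⟨J (U r x), hdom _⟩)‖ ≤ K * ‖x‖ := by
      rw [norm_neg, norm_smul, Complex.norm_I, one_mul, ← (U r).norm_map x]
      exact hK _
    have := convex_univ.norm_image_sub_le_of_norm_hasDerivWithin_le
      (fun r _ => (h.hasDerivAt_map hext ⟨x, hx⟩ r).hasDerivWithinAt) (fun r _ => hbound r)
      (mem_univ s) (mem_univ t)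
    rwa [Real.norm_eq_abs, mul_right_comm] at this
  · exact isClosed_le ((hJU t).sub (hJU s)).norm (continuous_const.mul continuous_norm)

theorem exists_isWeaklyLipschitzGroup_unitaryGroup [CompleteSpace H₁] [CompleteSpace H₀]
    {A : H₁ →ₗ.[ℂ] H₁} (hA : Dense (A.domain : Set H₁)) {J : H₁ →L[ℂ] H₀} {A₀ : H₀ →ₗ.[ℂ] H₀}
    (hdense : Dense (A₀.domain : Set H₀)) (hsymm : A₀.IsFormalAdjoint A₀)
    {hdom : ∀ x : H₁, J x ∈ A₀.domain}
    (hext : ∀ x : A.domain, A₀ ⟨J (x : H₁), hdom x⟩ = J (A x)) :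
    ∃ K : ℝ≥0, IsWeaklyLipschitzGroup J (unitaryGroup A) K := by
  unfold unitaryGroup
  split_ifs with h
  · exact h.choose_spec.exists_isWeaklyLipschitzGroup hA hdense hsymm hext
  · exact ⟨0, fun _ _ => rfl, fun _ _ _ => by simp⟩

end Embedding

section EssBounded

/-- A locally integrable real function whose absolute value is at most `M` almost everywhere. -/
structure EssBoundedBy (M : ℝ) (b : ℝ → ℝ) : Prop where
  locallyIntegrable : LocallyIntegrable b
  ae_abs_le : ∀ᵐ t, |b t| ≤ M

namespace EssBoundedBy

variable {M N g s t : ℝ} {b : ℝ → ℝ}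

theorem one : EssBoundedBy 1 fun _ => 1 :=
  ⟨locallyIntegrable_const 1, by simp⟩

theorem nonneg (hb : EssBoundedBy M b) : 0 ≤ M := by
  obtain ⟨x, hx⟩ := hb.ae_abs_le.exists
  exact (abs_nonneg _).trans hx

theorem mono (hb : EssBoundedBy M b) (hMN : M ≤ N) : EssBoundedBy N b :=
  ⟨hb.locallyIntegrable, hb.ae_abs_le.mono fun _ h => h.trans hMN⟩

theorem intervalIntegrable (hb : EssBoundedBy M b) (s t : ℝ) : IntervalIntegrable b volume s t :=
  (hb.locallyIntegrable.integrableOn_isCompact isCompact_uIcc).intervalIntegrable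

theorem continuous_primitive (hb : EssBoundedBy M b) : Continuous fun t => ∫ s in (0 : ℝ)..t, b s :=
  intervalIntegral.continuous_primitive hb.intervalIntegrable 0

theorem sub_one (hb : EssBoundedBy M b) : EssBoundedBy (M + 1) fun t => b t - 1 where
  locallyIntegrable := hb.locallyIntegrable.sub (locallyIntegrable_const 1)
  ae_abs_le := hb.ae_abs_le.mono fun t ht => (abs_sub _ _).trans (by simpa using ht)

theorem comp_mul_left (hb : EssBoundedBy M b) {c : ℝ} (hc : c ≠ 0) :
    EssBoundedBy M fun t => b (c * t) where
  locallyIntegrable x := by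
    refine ⟨Ioc (x - 1) (x + 1), Ioc_mem_nhds (by linarith) (by linarith), ?_⟩
    rw [← intervalIntegrable_iff_integrableOn_Ioc_of_le (by linarith)]
    simpa [mul_div_cancel_left₀ _ hc] using
      (hb.intervalIntegrable (c * (x - 1)) (c * (x + 1))).comp_mul_left (c := c)
  ae_abs_le := by
    have hquasi : Measure.QuasiMeasurePreserving (fun t : ℝ => c * t) volume volume := by
      refine ⟨measurable_const_mul c, ?_⟩
      rw [Real.map_volume_mul_left hc]
      exact Measure.smul_absolutelyContinuous
    exact hquasi.ae hb.ae_abs_le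

variable {E : Type*} [NormedAddCommGroup E] [NormedSpace ℝ E] {G : ℝ → E}

theorem intervalIntegrable_smul (hb : EssBoundedBy M b) (hG : ContinuousOn G (uIcc s t)) :
    IntervalIntegrable (fun r => b r • G r) volume s t :=
  (hb.intervalIntegrable s t).smul_continuousOn hG

theorem norm_integral_smul_le (hb : EssBoundedBy M b) (hst : s ≤ t) {c : ℝ → ℝ}
    (hc : IntervalIntegrable c volume s t) (hG : ∀ r ∈ Icc s t, ‖G r‖ ≤ c r) :
    ‖∫ r in s..t, b r • G r‖ ≤ M * ∫ r in s..t, c r := by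
  rw [← intervalIntegral.integral_const_mul]
  refine intervalIntegral.norm_integral_le_of_norm_le hst ?_ (hc.const_mul M)
  filter_upwards [hb.ae_abs_le] with r hr hrst
  rw [norm_smul]
  exact mul_le_mul hr (hG r (Ioc_subset_Icc_self hrst)) (norm_nonneg _) hb.nonneg

theorem norm_integral_smul_le_of_norm_le_const (hb : EssBoundedBy M b) (hst : s ≤ t)
    (hG : ∀ r ∈ Icc s t, ‖G r‖ ≤ g) : ‖∫ r in s..t, b r • G r‖ ≤ M * (g * (t - s)) := by
  simpa [mul_comm] using hb.norm_integral_smul_le hst intervalIntegrable_const hG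

variable [CompleteSpace E]

theorem norm_integral_smul_le_of_integral_eq_zero {ω : ℝ} (hb : EssBoundedBy M b) (hst : s ≤ t)
    (hmean : ∫ r in s..t, b r = 0) (hG : ContinuousOn G (Icc s t))
    (hosc : ∀ r ∈ Icc s t, ‖G r - G s‖ ≤ ω) :
    ‖∫ r in s..t, b r • G r‖ ≤ M * (ω * (t - s)) := by
  rw [← uIcc_of_le hst] at hG
  have hsub : ∫ r in s..t, b r • G r = ∫ r in s..t, b r • (G r - G s) := by
    simp_rw [smul_sub]
    rw [intervalIntegral.integral_sub (hb.intervalIntegrable_smul hG)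
      (hb.intervalIntegrable_smul continuousOn_const), intervalIntegral.integral_smul_const, hmean,
      zero_smul, sub_zero]
  rw [hsub]
  exact hb.norm_integral_smul_le_of_norm_le_const hst hosc

theorem norm_integral_smul_le_of_periodic_of_integral_eq_zero {h ω : ℝ} (hb : EssBoundedBy M b)
    (hh : 0 ≤ h) (hper : Function.Periodic b h) (hmean : ∫ r in (0 : ℝ)..h, b r = 0) (n : ℕ)
    (hG : ContinuousOn G (Icc 0 (n * h)))
    (hosc : ∀ r ∈ Icc 0 (n * h), ∀ s ∈ Icc 0 (n * h), |r - s| ≤ h → ‖G r - G s‖ ≤ ω) :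
    ‖∫ r in (0 : ℝ)..(n * h), b r • G r‖ ≤ M * (ω * (n * h)) := by
  have hnode {i : ℕ} (hi : i ≤ n) : (i : ℝ) * h ∈ Icc 0 (n * h) := ⟨by positivity, by gcongr⟩
  have hperiod (i : ℕ) (hi : i < n) :
      ‖∫ r in (i * h)..((i + 1 : ℕ) * h), b r • G r‖ ≤ M * (ω * h) := by
    have hsub : Icc (i * h) ((i + 1 : ℕ) * h) ⊆ Icc 0 (n * h) :=
      Icc_subset_Icc (hnode hi.le).1 (hnode hi).2
    have hlen : ((i + 1 : ℕ) : ℝ) * h = i * h + h := by push_cast; ring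
    rw [hlen] at hsub ⊢
    have := hb.norm_integral_smul_le_of_integral_eq_zero (le_add_of_nonneg_right hh)
      (by rw [hper.intervalIntegral_add_eq _ 0, zero_add, hmean]) (hG.mono hsub) fun r hr =>
        hosc r (hsub hr) _ (hnode hi.le) (abs_sub_le_iff.2 ⟨by linarith [hr.2], by linarith [hr.1]⟩)
    rwa [add_sub_cancel_left] at this
  have hsum := intervalIntegral.sum_integral_adjacent_intervals (a := fun i : ℕ => (i : ℝ) * h)
    fun i hi => hb.intervalIntegrable_smul
      (hG.mono (uIcc_subset_Icc (hnode (le_of_lt hi)) (hnode hi)))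
  simp only [Nat.cast_zero, zero_mul] at hsum
  rw [← hsum]
  refine (norm_sum_le_of_le _ fun i hi => hperiod i (Finset.mem_range.1 hi)).trans_eq ?_
  rw [Finset.sum_const, Finset.card_range, nsmul_eq_mul]
  ring

/-- Over each full period only the oscillation `ω` of `G` contributes, since the mean of `b`
vanishes; the incomplete last period contributes at most `M * (g * h)`. -/
theorem norm_integral_smul_le_of_periodic {h ω : ℝ} (hb : EssBoundedBy M b) (hh : 0 < h)
    (hper : Function.Periodic b h) (hmean : ∫ r in (0 : ℝ)..h, b r = 0) (ht : 0 ≤ t)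
    (hG : ContinuousOn G (Icc 0 t)) (hg : ∀ r ∈ Icc 0 t, ‖G r‖ ≤ g)
    (hosc : ∀ r ∈ Icc 0 t, ∀ s ∈ Icc 0 t, |r - s| ≤ h → ‖G r - G s‖ ≤ ω) :
    ‖∫ r in (0 : ℝ)..t, b r • G r‖ ≤ M * (ω * t + g * h) := by
  set k := ⌊t / h⌋₊
  have hkt : k * h ≤ t := (le_div_iff₀ hh).1 (Nat.floor_le (by positivity))
  have htk : t - k * h ≤ h := by
    linarith [(div_lt_iff₀ hh).1 (Nat.lt_floor_add_one (t / h))]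
  have hk : (k : ℝ) * h ∈ Icc 0 t := ⟨by positivity, hkt⟩
  have h0 : (0 : ℝ) ∈ Icc 0 t := left_mem_Icc.2 ht
  have hω : 0 ≤ ω := (norm_nonneg _).trans (hosc 0 h0 0 h0 (by simpa using hh.le))
  have hg₀ : 0 ≤ g := (norm_nonneg _).trans (hg 0 h0)
  have hM := hb.nonneg
  have hint {r s : ℝ} (hr : r ∈ Icc 0 t) (hs : s ∈ Icc 0 t) :
      IntervalIntegrable (fun r => b r • G r) volume r s :=
    hb.intervalIntegrable_smul (hG.mono (uIcc_subset_Icc hr hs))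
  have hsub : Icc 0 (k * h) ⊆ Icc 0 t := Icc_subset_Icc_right hkt
  have hperiods := hb.norm_integral_smul_le_of_periodic_of_integral_eq_zero hh.le hper hmean k
    (hG.mono hsub) fun r hr s hs => hosc r (hsub hr) s (hsub hs)
  have hrest := hb.norm_integral_smul_le_of_norm_le_const hkt
    fun r hr => hg r (Icc_subset_Icc_left hk.1 hr)
  rw [← intervalIntegral.integral_add_adjacent_intervals
    (hint h0 hk) (hint hk (right_mem_Icc.2 ht))]
  calc _ ≤ M * (ω * (k * h)) + M * (g * (t - k * h)) := norm_add_le_of_le hperiods hrest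
    _ ≤ M * (ω * t) + M * (g * h) := by gcongr
    _ = M * (ω * t + g * h) := by ring

end EssBoundedBy

end EssBounded

namespace IsSplittingCoefficient

variable {M T h ω g t : ℝ} {a b : ℝ → ℝ}

theorem period_ne_zero (ha : IsSplittingCoefficient T a) : T ≠ 0 := by
  rintro rfl
  simpa using ha.mean

theorem integral_eq (ha : IsSplittingCoefficient T a) : ∫ t in (0 : ℝ)..T, a t = T :=
  (div_eq_one_iff_eq ha.period_ne_zero).1 ha.mean

theorem exists_essBoundedBy (ha : IsSplittingCoefficient T a) : ∃ M, EssBoundedBy M a :=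
  ha.bounded.imp fun _ hM => ⟨ha.locallyIntegrable, hM⟩

theorem comp_nat_mul (ha : IsSplittingCoefficient T a) {n : ℕ} (hn : n ≠ 0) :
    IsSplittingCoefficient (T / n) fun t => a (n * t) := by
  have hn' : (n : ℝ) ≠ 0 := Nat.cast_ne_zero.2 hn
  obtain ⟨M, hM⟩ := ha.exists_essBoundedBy
  refine ⟨(hM.comp_mul_left hn').locallyIntegrable, ⟨M, (hM.comp_mul_left hn').ae_abs_le⟩,
    fun t => ?_, ?_⟩
  · rw [mul_add, mul_div_cancel₀ _ hn']
    exact ha.periodic _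
  · rw [intervalIntegral.integral_comp_mul_left _ hn', mul_zero, mul_div_cancel₀ _ hn',
      ha.integral_eq, smul_eq_mul, inv_mul_eq_div, div_self (div_ne_zero ha.period_ne_zero hn')]

variable {E : Type*} [NormedAddCommGroup E] [NormedSpace ℝ E] [CompleteSpace E]

theorem norm_integral_sub_one_smul_le {G : ℝ → E} (hb : IsSplittingCoefficient h b)
    (hbM : EssBoundedBy M b) (hh : 0 < h) (ht : 0 ≤ t) (hG : ContinuousOn G (Icc 0 t))
    (hg : ∀ r ∈ Icc 0 t, ‖G r‖ ≤ g)
    (hosc : ∀ r ∈ Icc 0 t, ∀ s ∈ Icc 0 t, |r - s| ≤ h → ‖G r - G s‖ ≤ ω) :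
    ‖∫ s in (0 : ℝ)..t, (b s - 1) • G s‖ ≤ (M + 1) * (ω * t + g * h) := by
  refine hbM.sub_one.norm_integral_smul_le_of_periodic hh (fun t => by simp only [hb.periodic t]) ?_
    ht hG hg hosc
  rw [intervalIntegral.integral_sub (hbM.intervalIntegrable _ _) intervalIntegrable_const,
    hb.integral_eq]
  simp

theorem abs_integral_sub_le (ha : IsSplittingCoefficient h a) (haM : EssBoundedBy M a) (hh : 0 < h)
    (ht : 0 ≤ t) : |(∫ s in (0 : ℝ)..t, a s) - t| ≤ (M + 1) * h := by
  have := ha.norm_integral_sub_one_smul_le (G := fun _ => (1 : ℝ)) (ω := 0) (g := 1) haM hh ht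
    continuousOn_const (by simp) (by simp)
  simp only [smul_eq_mul, mul_one, zero_mul, zero_add, one_mul] at this
  rw [intervalIntegral.integral_sub (haM.intervalIntegrable _ _) intervalIntegrable_const] at this
  simpa using this

theorem integral_mem_Icc (ha : IsSplittingCoefficient h a) (haM : EssBoundedBy M a) (hh : 0 < h)
    (hh₁ : (M + 1) * h ≤ 1) (ht : t ∈ Icc 0 T) :
    (∫ s in (0 : ℝ)..t, a s) ∈ Icc (-1) (T + 1) := by
  have := abs_le.1 ((ha.abs_integral_sub_le haM hh ht.1).trans hh₁)
  exact ⟨by linarith [ht.1], by linarith [ht.2]⟩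

theorem norm_integral_smul_sub_integral_le {G₁ G₂ : ℝ → E} (hb : IsSplittingCoefficient h b)
    (hbM : EssBoundedBy M b) (hh : 0 < h) (ht : 0 ≤ t) (hG₁ : ContinuousOn G₁ (Icc 0 t))
    (hG₂ : ContinuousOn G₂ (Icc 0 t)) (hω : ∀ s ∈ Icc 0 t, ‖G₁ s - G₂ s‖ ≤ ω)
    (hg : ∀ s ∈ Icc 0 t, ‖G₂ s‖ ≤ g)
    (hosc : ∀ r ∈ Icc 0 t, ∀ s ∈ Icc 0 t, |r - s| ≤ h → ‖G₂ r - G₂ s‖ ≤ ω) :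
    ‖(∫ s in (0 : ℝ)..t, b s • G₁ s) - ∫ s in (0 : ℝ)..t, G₂ s‖ ≤
      (2 * M + 1) * ω * t + (M + 1) * g * h := by
  have hu : uIcc 0 t = Icc 0 t := uIcc_of_le ht
  have hi₁ := hbM.intervalIntegrable_smul (hu ▸ hG₁)
  have hi₂ := hbM.intervalIntegrable_smul (hu ▸ hG₂)
  have hi₃ := (hu ▸ hG₂ : ContinuousOn G₂ (uIcc 0 t)).intervalIntegrable (μ := volume)
  have hsplit : (∫ s in (0 : ℝ)..t, b s • G₁ s) - ∫ s in (0 : ℝ)..t, G₂ s =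
      (∫ s in (0 : ℝ)..t, b s • (G₁ s - G₂ s)) + ∫ s in (0 : ℝ)..t, (b s - 1) • G₂ s := by
    simp_rw [smul_sub, sub_smul, one_smul]
    rw [intervalIntegral.integral_sub hi₁ hi₂, intervalIntegral.integral_sub hi₂ hi₃,
      sub_add_sub_cancel]
  rw [hsplit]
  calc _ ≤ M * (ω * (t - 0)) + (M + 1) * (ω * t + g * h) :=
        norm_add_le_of_le (hbM.norm_integral_smul_le_of_norm_le_const ht hω)
          (hb.norm_integral_sub_one_smul_le hbM hh ht hG₂ hg hosc)
    _ = (2 * M + 1) * ω * t + (M + 1) * g * h := by ring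

theorem norm_integral_smul_comp_primitive_sub_le {G : ℝ → ℝ → E} (ha : IsSplittingCoefficient h a)
    (haM : EssBoundedBy M a) (hb : IsSplittingCoefficient h b) (hbM : EssBoundedBy M b) (hh : 0 < h)
    (hh₁ : (M + 1) * h ≤ 1) (ht : t ∈ Icc 0 T)
    (hG : ContinuousOn (fun p : ℝ × ℝ => G p.1 p.2) (Icc (-1) (T + 1) ×ˢ Icc 0 T))
    (hg : ∀ τ ∈ Icc (-1) (T + 1), ∀ s ∈ Icc 0 T, ‖G τ s‖ ≤ g)
    (hosc : ∀ τ ∈ Icc (-1) (T + 1), ∀ τ' ∈ Icc (-1) (T + 1), ∀ s ∈ Icc 0 T, ∀ s' ∈ Icc 0 T,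
      |τ - τ'| ≤ (M + 1) * h → |s - s'| ≤ (M + 1) * h → ‖G τ s - G τ' s'‖ ≤ ω) :
    ‖(∫ s in (0 : ℝ)..t, b s • G (∫ r in (0 : ℝ)..s, a r) s) - ∫ s in (0 : ℝ)..t, G s s‖ ≤
      (2 * M + 1) * ω * T + (M + 1) * g * h := by
  have hM := hbM.nonneg
  have hhM : h ≤ (M + 1) * h := le_mul_of_one_le_left hh.le (by linarith)
  have hφ {s : ℝ} (hs : s ∈ Icc 0 t) : |(∫ r in (0 : ℝ)..s, a r) - s| ≤ (M + 1) * h :=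
    ha.abs_integral_sub_le haM hh hs.1
  have hT {s : ℝ} (hs : s ∈ Icc 0 t) : s ∈ Icc 0 T := ⟨hs.1, hs.2.trans ht.2⟩
  have hT₁ {s : ℝ} (hs : s ∈ Icc 0 t) : s ∈ Icc (-1) (T + 1) :=
    ⟨by linarith [hs.1], by linarith [(hT hs).2]⟩
  have hφT₁ {s : ℝ} (hs : s ∈ Icc 0 t) : (∫ r in (0 : ℝ)..s, a r) ∈ Icc (-1) (T + 1) :=
    ha.integral_mem_Icc haM hh hh₁ (hT hs)
  have hω : 0 ≤ ω := by
    have h0 : (0 : ℝ) ∈ Icc 0 t := left_mem_Icc.2 ht.1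
    exact (norm_nonneg _).trans (hosc 0 (hT₁ h0) 0 (hT₁ h0) 0 (hT h0) 0 (hT h0)
      (by simpa using hh.le.trans hhM) (by simpa using hh.le.trans hhM))
  refine (hb.norm_integral_smul_sub_integral_le (ω := ω) (g := g) hbM hh ht.1
    (hG.comp (haM.continuous_primitive.prodMk continuous_id).continuousOn
      fun s hs => ⟨hφT₁ hs, hT hs⟩)
    (hG.comp (continuous_id.prodMk continuous_id).continuousOn fun s hs => ⟨hT₁ hs, hT hs⟩)
    (fun s hs => hosc _ (hφT₁ hs) _ (hT₁ hs) _ (hT hs) _ (hT hs) (hφ hs)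
      (by simpa using hh.le.trans hhM))
    (fun s hs => hg s (hT₁ hs) s (hT hs))
    fun r hr s hs hrs => hosc r (hT₁ hr) s (hT₁ hs) r (hT hr) s (hT hs) (hrs.trans hhM)
      (hrs.trans hhM)).trans ?_
  gcongr
  exact ht.2

end IsSplittingCoefficient

section Lipschitz

theorem exists_lipschitzOnWith_closedBall_of_isCompact {X Y : Type*} [PseudoMetricSpace X]
    [PseudoMetricSpace Y] {f : X → Y} (hf : LocallyLipschitz f) {s : Set X} (hs : IsCompact s) :
    ∃ ε > (0 : ℝ), ∃ L : ℝ≥0, ∀ x ∈ s, LipschitzOnWith L f (closedBall x ε) := by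
  refine hs.induction_on ⟨1, one_pos, 0, by simp⟩ ?_ ?_ ?_
  · rintro s t hst ⟨ε, hε, L, hL⟩
    exact ⟨ε, hε, L, fun x hx => hL x (hst hx)⟩
  · rintro s t ⟨ε, hε, L, hL⟩ ⟨ε', hε', L', hL'⟩
    refine ⟨min ε ε', lt_min hε hε', max L L', ?_⟩
    rintro x (hx | hx)
    · exact ((hL x hx).weaken (le_max_left _ _)).mono
        (closedBall_subset_closedBall (min_le_left _ _))
    · exact ((hL' x hx).weaken (le_max_right _ _)).mono
        (closedBall_subset_closedBall (min_le_right _ _))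
  · intro x _
    obtain ⟨L, t, ht, hL⟩ := hf x
    obtain ⟨ε, hε, hball⟩ := Metric.mem_nhds_iff.1 ht
    refine ⟨ball x (ε / 2), mem_nhdsWithin_of_mem_nhds (ball_mem_nhds x (half_pos hε)),
      ε / 4, by positivity, L, fun y hy => hL.mono (Subset.trans ?_ hball)⟩
    exact closedBall_subset_ball' (by linarith [mem_ball.1 hy])

theorem norm_sub_le_of_forall_norm_sub_lt {E F G : Type*} [NormedAddCommGroup E] [NormedSpace ℝ E]
    [SeminormedAddCommGroup F] [SeminormedAddCommGroup G] [NormedSpace ℝ G] (J : E →ₗ[ℝ] G)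
    {f : E → F} {s : Set E} (hs : Convex ℝ s) {Λ δ : ℝ} (hδ : 0 < δ)
    (hf : ∀ x ∈ s, ∀ y ∈ s, ‖y - x‖ < δ → ‖f y - f x‖ ≤ Λ * ‖J (y - x)‖) {x y : E} (hx : x ∈ s)
    (hy : y ∈ s) : ‖f y - f x‖ ≤ Λ * ‖J (y - x)‖ := by
  obtain ⟨n, hn⟩ := exists_nat_gt (‖y - x‖ / δ)
  have hn₀ : (0 : ℝ) < n := (by positivity : 0 ≤ ‖y - x‖ / δ).trans_lt hn
  let z : ℕ → E := fun i => AffineMap.lineMap x y (i / n : ℝ)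
  have hz {i : ℕ} (hi : i ≤ n) : z i ∈ s :=
    hs.lineMap_mem hx hy ⟨by positivity, (div_le_one hn₀).2 (Nat.cast_le.2 hi)⟩
  have hstep (i : ℕ) : z (i + 1) - z i = (n : ℝ)⁻¹ • (y - x) := by
    simp only [z, AffineMap.lineMap_apply_module']
    rw [add_sub_add_right_eq_sub, ← sub_smul]
    congr 1
    push_cast
    ring
  have hnorm : ‖(n : ℝ)⁻¹ • (y - x)‖ < δ := by
    rw [norm_smul, norm_inv, Real.norm_natCast, inv_mul_lt_iff₀ hn₀, ← div_lt_iff₀ hδ]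
    exact hn
  have hle {i : ℕ} (hi : i < n) :
      dist (f (z i)) (f (z (i + 1))) ≤ Λ * ((n : ℝ)⁻¹ * ‖J (y - x)‖) := by
    rw [dist_comm, dist_eq_norm]
    have := hf _ (hz hi.le) _ (hz hi) (by rwa [hstep])
    rwa [hstep, map_smul, norm_smul, norm_inv, Real.norm_natCast] at this
  have hz₀ : z 0 = x := by simp [z]
  have hzn : z n = y := by simp [z, hn₀.ne']
  calc ‖f y - f x‖ = dist (f (z 0)) (f (z n)) := by rw [hz₀, hzn, dist_comm, dist_eq_norm]
    _ ≤ ∑ _ ∈ Finset.range n, Λ * ((n : ℝ)⁻¹ * ‖J (y - x)‖) :=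
        dist_le_range_sum_of_dist_le n hle
    _ = Λ * ‖J (y - x)‖ := by
        rw [Finset.sum_const, Finset.card_range, nsmul_eq_mul]
        field_simp

variable {H₁ H₀ : Type*} [NormedAddCommGroup H₁] [InnerProductSpace ℂ H₁]
  [NormedAddCommGroup H₀] [InnerProductSpace ℂ H₀]

/-- On bounded subsets of `H₁` the map `B` is Lipschitz for the weaker norm of `H₀`; as usual, `J`
is the embedding of `H₁` in `H₀`. This is what the convergence proof extracts from a uniform
derivative. -/
def IsWeaklyLipschitzOnBounded (J : H₁ →L[ℂ] H₀) (B : H₁ → H₁) : Prop :=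
  ∀ R : ℝ, ∃ Λ : ℝ≥0, ∀ x y : H₁, ‖x‖ ≤ R → ‖y‖ ≤ R → ‖J (B x) - J (B y)‖ ≤ Λ * ‖J (x - y)‖

/-- The defining estimate bounds increments shorter than `δ`; larger ones are subdivided. -/
theorem HasUniformDerivative.isWeaklyLipschitzOnBounded {J : H₁ →L[ℂ] H₀} {B : H₁ → H₁}
    {B' : H₁ → H₀ →L[ℝ] H₀} (h : HasUniformDerivative J B B') : IsWeaklyLipschitzOnBounded J B := by
  intro R
  obtain ⟨C, hC, δ, hδ, hCδ⟩ := h (max R 1) (lt_max_of_lt_right one_pos) 1 one_pos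
  have hsmall (x : H₁) (hx : x ∈ closedBall 0 R) (y : H₁) (_ : y ∈ closedBall 0 R)
      (hxy : ‖y - x‖ < δ) : ‖J (B y) - J (B x)‖ ≤ (C + 1) * ‖J (y - x)‖ := by
    obtain ⟨hB', hrem⟩ :=
      hCδ x (y - x) ((mem_closedBall_zero_iff.1 hx).trans (le_max_left _ _)) hxy
    rw [add_sub_cancel] at hrem
    calc ‖J (B y) - J (B x)‖ = ‖B' x (J (y - x)) + (J (B y) - J (B x) - B' x (J (y - x)))‖ := by
          rw [add_sub_cancel]
      _ ≤ C * ‖J (y - x)‖ + 1 * ‖J (y - x)‖ :=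
          norm_add_le_of_le ((B' x).le_of_opNorm_le hB' _) hrem
      _ = (C + 1) * ‖J (y - x)‖ := by ring
  refine ⟨⟨C + 1, by positivity⟩, fun x y hx hy => ?_⟩
  exact norm_sub_le_of_forall_norm_sub_lt (f := fun x => J (B x)) (J.restrictScalars ℝ).toLinearMap
    (convex_closedBall 0 R) hδ hsmall (mem_closedBall_zero_iff.2 hy) (mem_closedBall_zero_iff.2 hx)

end Lipschitz

section Caratheodory

theorem le_mul_exp_of_le_add_integral {f : ℝ → ℝ} {δ K T : ℝ} (hK : 0 ≤ K)
    (hf : ContinuousOn f (Icc 0 T)) (h : ∀ t ∈ Icc 0 T, f t ≤ δ + K * ∫ s in (0 : ℝ)..t, f s)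
    {t : ℝ} (ht : t ∈ Icc 0 T) : f t ≤ δ * Real.exp (K * t) := by
  have hT : 0 ≤ T := ht.1.trans ht.2
  have hcont : ContinuousOn (fun t => δ + K * ∫ s in (0 : ℝ)..t, f s) (Icc 0 T) := by
    rw [← uIcc_of_le hT] at hf ⊢
    exact continuousOn_const.add (continuousOn_const.mul
      (intervalIntegral.continuousOn_primitive_interval hf.integrableOn_uIcc))
  have hderiv (x : ℝ) (hx : x ∈ Ico 0 T) :
      HasDerivWithinAt (fun t => δ + K * ∫ s in (0 : ℝ)..t, f s) (K * f x) (Ici x) x := by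
    have hmem : Icc 0 T ∈ 𝓝[>] x :=
      mem_of_superset (Ioc_mem_nhdsGT hx.2) (Ioc_subset_Icc_self.trans (Icc_subset_Icc_left hx.1))
    have hx' : x ∈ Icc 0 T := Ico_subset_Icc_self hx
    have hint : IntervalIntegrable f volume 0 x :=
      (hf.mono (uIcc_subset_Icc (left_mem_Icc.2 hT) hx')).intervalIntegrable
    refine ((intervalIntegral.integral_hasDerivWithinAt_right (t := Ioi x) hint ?_ ?_).const_mul
      K).const_add δ
    · exact (hf.stronglyMeasurableAtFilter_nhdsWithin measurableSet_Icc x).filter_mono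
        (nhdsWithin_le_iff.2 hmem)
    · exact (hf x hx').mono_of_mem_nhdsWithin hmem
  have hgr := le_gronwallBound_of_liminf_deriv_right_le (δ := δ) (K := K) (ε := 0) hcont
    (fun x hx _ hr => (hderiv x hx).liminf_right_slope_le hr) (by simp)
    (fun x hx => by simpa using mul_le_mul_of_nonneg_left (h x (Ico_subset_Icc_self hx)) hK) t ht
  rw [gronwallBound_ε0, sub_zero] at hgr
  exact (h t ht).trans hgr

variable {E : Type*} [NormedAddCommGroup E] [NormedSpace ℝ E]

theorem EssBoundedBy.norm_sub_le_mul_exp {M D Λ T t : ℝ} {b : ℝ → ℝ} {x₀ : E} {w v P Q R : ℝ → E}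
    (hb : EssBoundedBy M b) (hΛ : 0 ≤ Λ) (hw : ContinuousOn w (Icc 0 T))
    (hv : ContinuousOn v (Icc 0 T)) (hP : ContinuousOn P (Icc 0 T)) (hQ : ContinuousOn Q (Icc 0 T))
    (hwP : ∀ t ∈ Icc 0 T, w t = x₀ + ∫ s in (0 : ℝ)..t, b s • P s)
    (hvR : ∀ t ∈ Icc 0 T, v t = x₀ + ∫ s in (0 : ℝ)..t, R s)
    (hPQ : ∀ s ∈ Icc 0 T, ‖P s - Q s‖ ≤ Λ * ‖w s - v s‖)
    (hQR : ∀ t ∈ Icc 0 T, ‖(∫ s in (0 : ℝ)..t, b s • Q s) - ∫ s in (0 : ℝ)..t, R s‖ ≤ D)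
    (ht : t ∈ Icc 0 T) : ‖w t - v t‖ ≤ D * Real.exp (M * Λ * t) := by
  have hnorm : ContinuousOn (fun s => ‖w s - v s‖) (Icc 0 T) := (hw.sub hv).norm
  refine le_mul_exp_of_le_add_integral (mul_nonneg hb.nonneg hΛ) hnorm (fun t ht => ?_) ht
  have hsub : uIcc 0 t ⊆ Icc 0 T := uIcc_subset_Icc ⟨le_rfl, ht.1.trans ht.2⟩ ht
  have hsplit : w t - v t = ((∫ s in (0 : ℝ)..t, b s • Q s) - ∫ s in (0 : ℝ)..t, R s) +
      ∫ s in (0 : ℝ)..t, b s • (P s - Q s) := by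
    simp_rw [smul_sub]
    rw [intervalIntegral.integral_sub (hb.intervalIntegrable_smul (hP.mono hsub))
      (hb.intervalIntegrable_smul (hQ.mono hsub)), hwP t ht, hvR t ht]
    abel
  have hint : ‖∫ s in (0 : ℝ)..t, b s • (P s - Q s)‖ ≤ M * ∫ s in (0 : ℝ)..t, Λ * ‖w s - v s‖ :=
    hb.norm_integral_smul_le ht.1 ((hnorm.mono hsub).intervalIntegrable.const_mul Λ)
      fun s hs => hPQ s ⟨hs.1, hs.2.trans ht.2⟩
  rw [hsplit]
  refine (norm_add_le_of_le (hQR t ht) hint).trans_eq ?_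
  rw [intervalIntegral.integral_const_mul, ← mul_assoc]

/-- `w` is a continuous solution on `[0,T]` of the integrated form of `w' = F(t, w)`, `w(0) = x₀`;
the field `F` need only be integrable in time. -/
def IsCaratheodorySolution (F : ℝ → E → E) (x₀ : E) (T : ℝ) (w : ℝ → E) : Prop :=
  ContinuousOn w (Icc 0 T) ∧ ∀ t ∈ Icc (0 : ℝ) T, w t = x₀ + ∫ s in (0 : ℝ)..t, F s (w s)

theorem exists_isFixedPt_of_lipschitzOnWith_closedBall {X : Type*} [MetricSpace X]
    [CompleteSpace X] {Φ : X → X} {K : ℝ≥0} {x : X} {r : ℝ} (hK : K < 1) (hr : 0 ≤ r)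
    (hΦ : LipschitzOnWith K Φ (closedBall x r)) (hx : dist (Φ x) x ≤ (1 - K) * r) :
    ∃ y ∈ closedBall x r, Function.IsFixedPt Φ y := by
  have hmaps : MapsTo Φ (closedBall x r) (closedBall x r) := fun y hy => mem_closedBall.2 <|
    calc dist (Φ y) x ≤ dist (Φ y) (Φ x) + dist (Φ x) x := dist_triangle _ _ _
      _ ≤ K * r + (1 - K) * r := by
          gcongr
          exact (hΦ.dist_le_mul y hy x (mem_closedBall_self hr)).trans (by gcongr; exact hy)
      _ = r := by ring
  obtain ⟨y, hy, hfix, -⟩ := ContractingWith.exists_fixedPoint' isClosed_closedBall.isComplete hmaps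
    ⟨hK, hΦ.mapsToRestrict hmaps⟩ (mem_closedBall_self hr) (edist_ne_top _ _)
  exact ⟨y, hy, hfix⟩

theorem exp_neg_mul_integral_exp_le {l t : ℝ} (hl : 0 < l) :
    Real.exp (-(l * t)) * ∫ s in (0 : ℝ)..t, Real.exp (l * s) ≤ 1 / l := by
  have hint : ∫ s in (0 : ℝ)..t, Real.exp (l * s) = (Real.exp (l * t) - 1) / l := by
    rw [intervalIntegral.integral_comp_mul_left _ hl.ne']
    simp [div_eq_inv_mul]
  rw [hint, mul_div_assoc', mul_sub, ← Real.exp_add, neg_add_cancel, Real.exp_zero, mul_one]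
  gcongr
  linarith [Real.exp_pos (-(l * t))]

/-- The perturbation of the curve `v` encoded by `z`: the uniform norm of `z` is Bielecki's
weighted norm, with weight `exp (-l s)`, of the difference to `v`. -/
noncomputable def weightedPerturbation {T : ℝ} (hT : 0 ≤ T) (l : ℝ) (v : ℝ → E)
    (z : C(Icc (0 : ℝ) T, E)) (s : ℝ) : E :=
  v s + Real.exp (l * s) • IccExtend hT z s

section weightedPerturbation

variable {T : ℝ} {hT : 0 ≤ T} {l : ℝ} {v : ℝ → E}

theorem continuousOn_weightedPerturbation (hv : ContinuousOn v (Icc 0 T))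
    (z : C(Icc (0 : ℝ) T, E)) : ContinuousOn (weightedPerturbation hT l v z) (Icc 0 T) := by
  have hz : Continuous (IccExtend hT z) := z.continuous.Icc_extend'
  have hexp : Continuous fun s : ℝ => Real.exp (l * s) := by fun_prop
  exact hv.add (hexp.smul hz).continuousOn

theorem weightedPerturbation_zero : weightedPerturbation hT l v 0 = v := by
  funext s
  simp [weightedPerturbation, IccExtend]

theorem norm_weightedPerturbation_sub_le (z z' : C(Icc (0 : ℝ) T, E)) (s : ℝ) :
    ‖weightedPerturbation hT l v z s - weightedPerturbation hT l v z' s‖ ≤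
      Real.exp (l * s) * dist z z' := by
  rw [weightedPerturbation, weightedPerturbation, add_sub_add_left_eq_sub, ← smul_sub, norm_smul,
    Real.norm_eq_abs, Real.abs_exp, ← dist_eq_norm]
  exact mul_le_mul_of_nonneg_left (ContinuousMap.dist_apply_le_dist _) (Real.exp_pos _).le

theorem weightedPerturbation_mem_closedBall {z : C(Icc (0 : ℝ) T, E)} {r s : ℝ} (hl : 0 ≤ l)
    (hz : z ∈ closedBall 0 r) (hs : s ∈ Icc 0 T) :
    weightedPerturbation hT l v z s ∈ closedBall (v s) (r * Real.exp (l * T)) := by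
  have hzs := norm_weightedPerturbation_sub_le (hT := hT) (l := l) (v := v) z 0 s
  rw [weightedPerturbation_zero] at hzs
  rw [mem_closedBall_iff_norm, mul_comm]
  refine hzs.trans (mul_le_mul ?_ hz dist_nonneg (Real.exp_pos _).le)
  exact Real.exp_le_exp.2 (mul_le_mul_of_nonneg_left hs.2 hl)

end weightedPerturbation

section Picard

variable {M T : ℝ} {b : ℝ → ℝ} {f : ℝ → E → E} {v : ℝ → E}

/-- The Picard iteration for `w' = b(t) f(t, w)`, `w(0) = x₀`, transported to perturbations of `v`
through `weightedPerturbation`. -/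
noncomputable def weightedPicard (hT : 0 ≤ T) (hb : EssBoundedBy M b)
    (hf : Continuous fun p : ℝ × E => f p.1 p.2) (hv : ContinuousOn v (Icc 0 T)) (x₀ : E) (l : ℝ)
    (z : C(Icc (0 : ℝ) T, E)) : C(Icc (0 : ℝ) T, E) where
  toFun t := Real.exp (-(l * t)) •
    (x₀ + (∫ s in (0 : ℝ)..t, b s • f s (weightedPerturbation hT l v z s)) - v t)
  continuous_toFun := by
    have hfz : ContinuousOn (fun s => f s (weightedPerturbation hT l v z s)) (Icc 0 T) :=
      hf.comp_continuousOn (continuousOn_id.prodMk (continuousOn_weightedPerturbation hv z))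
    rw [← uIcc_of_le hT] at hfz
    have hprim := intervalIntegral.continuousOn_primitive_interval'
      (hb.intervalIntegrable_smul hfz) left_mem_uIcc
    rw [uIcc_of_le hT] at hprim
    have hexp : Continuous fun t : Icc (0 : ℝ) T => Real.exp (-(l * t)) := by fun_prop
    exact hexp.smul (continuousOn_iff_continuous_domRestrict.1
      ((continuousOn_const.add hprim).sub hv))

variable {hT : 0 ≤ T} {hb : EssBoundedBy M b} {hf : Continuous fun p : ℝ × E => f p.1 p.2}
  {hv : ContinuousOn v (Icc 0 T)} {x₀ : E} {l : ℝ}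

theorem dist_weightedPicard_le {L : ℝ} (hL : 0 ≤ L) (hl : 0 < l) {z z' : C(Icc (0 : ℝ) T, E)}
    (hlip : ∀ s ∈ Icc 0 T,
      ‖f s (weightedPerturbation hT l v z s) - f s (weightedPerturbation hT l v z' s)‖ ≤
        L * ‖weightedPerturbation hT l v z s - weightedPerturbation hT l v z' s‖) :
    dist (weightedPicard hT hb hf hv x₀ l z) (weightedPicard hT hb hf hv x₀ l z') ≤
      M * L / l * dist z z' := by
  have hM := hb.nonneg
  rw [ContinuousMap.dist_le (by positivity)]
  rintro ⟨t, ht⟩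
  have hcont (z : C(Icc (0 : ℝ) T, E)) :
      ContinuousOn (fun s => f s (weightedPerturbation hT l v z s)) (uIcc 0 t) :=
    hf.comp_continuousOn (continuousOn_id.prodMk ((continuousOn_weightedPerturbation hv z).mono
      (uIcc_subset_Icc ⟨le_rfl, hT⟩ ht)))
  have hint : ‖∫ s in (0 : ℝ)..t,
      b s • (f s (weightedPerturbation hT l v z s) - f s (weightedPerturbation hT l v z' s))‖ ≤
      M * ∫ s in (0 : ℝ)..t, L * dist z z' * Real.exp (l * s) := by
    refine hb.norm_integral_smul_le ht.1 (Continuous.intervalIntegrable (by fun_prop) _ _)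
      fun s hs => (hlip s ⟨hs.1, hs.2.trans ht.2⟩).trans ?_
    rw [mul_assoc, mul_comm (dist z z')]
    exact mul_le_mul_of_nonneg_left (norm_weightedPerturbation_sub_le z z' s) hL
  simp_rw [smul_sub] at hint
  rw [intervalIntegral.integral_sub (hb.intervalIntegrable_smul (hcont z))
    (hb.intervalIntegrable_smul (hcont z')), intervalIntegral.integral_const_mul] at hint
  simp only [weightedPicard, ContinuousMap.coe_mk]
  rw [dist_eq_norm, ← smul_sub, norm_smul, Real.norm_eq_abs, Real.abs_exp,
    sub_sub_sub_cancel_right, add_sub_add_left_eq_sub]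
  calc _ ≤ Real.exp (-(l * t)) *
        (M * (L * dist z z' * ∫ s in (0 : ℝ)..t, Real.exp (l * s))) := by gcongr
    _ = M * L * dist z z' * (Real.exp (-(l * t)) * ∫ s in (0 : ℝ)..t, Real.exp (l * s)) := by ring
    _ ≤ M * L * dist z z' * (1 / l) := by gcongr; exact exp_neg_mul_integral_exp_le hl
    _ = M * L / l * dist z z' := by ring

theorem norm_weightedPicard_zero_le {η : ℝ} (hl : 0 ≤ l)
    (hdefect : ∀ t ∈ Icc 0 T, ‖x₀ + (∫ s in (0 : ℝ)..t, b s • f s (v s)) - v t‖ ≤ η) :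
    ‖weightedPicard hT hb hf hv x₀ l 0‖ ≤ η := by
  rw [ContinuousMap.norm_le _ ((norm_nonneg _).trans (hdefect 0 ⟨le_rfl, hT⟩))]
  rintro ⟨t, ht⟩
  simp only [weightedPicard, ContinuousMap.coe_mk, weightedPerturbation_zero]
  rw [norm_smul, Real.norm_eq_abs, Real.abs_exp]
  refine (mul_le_of_le_one_left (norm_nonneg _) ?_).trans (hdefect t ht)
  exact Real.exp_le_one_iff.2 (neg_nonpos.2 (mul_nonneg hl ht.1))

theorem isCaratheodorySolution_of_isFixedPt_weightedPicard {z : C(Icc (0 : ℝ) T, E)}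
    (hz : Function.IsFixedPt (weightedPicard hT hb hf hv x₀ l) z) :
    IsCaratheodorySolution (fun s x => b s • f s x) x₀ T (weightedPerturbation hT l v z) := by
  refine ⟨continuousOn_weightedPerturbation hv z, fun t ht => ?_⟩
  have hzt : z ⟨t, ht⟩ = Real.exp (-(l * t)) •
      (x₀ + (∫ s in (0 : ℝ)..t, b s • f s (weightedPerturbation hT l v z s)) - v t) :=
    (DFunLike.congr_fun hz.eq ⟨t, ht⟩).symm
  rw [weightedPerturbation, IccExtend_of_mem hT _ ht, hzt, smul_smul, ← Real.exp_add,
    add_neg_cancel, Real.exp_zero, one_smul, add_sub_cancel]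

theorem exists_isCaratheodorySolution_of_defect_le [CompleteSpace E] {L : ℝ≥0} {ε η : ℝ}
    (hT : 0 ≤ T) (hb : EssBoundedBy M b) (hf : Continuous fun p : ℝ × E => f p.1 p.2)
    (hv : ContinuousOn v (Icc 0 T))
    (hlip : ∀ s ∈ Icc 0 T, LipschitzOnWith L (f s) (closedBall (v s) ε))
    (hdefect : ∀ t ∈ Icc 0 T, ‖x₀ + (∫ s in (0 : ℝ)..t, b s • f s (v s)) - v t‖ ≤ η)
    (hη : 2 * η * Real.exp ((2 * M * L + 1) * T) ≤ ε) :
    ∃ w, IsCaratheodorySolution (fun s x => b s • f s x) x₀ T w ∧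
      ∀ t ∈ Icc 0 T, w t ∈ closedBall (v t) ε := by
  have hM := hb.nonneg
  have hη₀ : 0 ≤ η := (norm_nonneg _).trans (hdefect 0 ⟨le_rfl, hT⟩)
  set l : ℝ := 2 * M * L + 1
  have hl : 0 < l := by positivity
  have htube {z} (hz : z ∈ closedBall (0 : C(Icc (0 : ℝ) T, E)) (2 * η)) {s : ℝ}
      (hs : s ∈ Icc 0 T) : weightedPerturbation hT l v z s ∈ closedBall (v s) ε :=
    closedBall_subset_closedBall hη (weightedPerturbation_mem_closedBall hl.le hz hs)
  have hcontr :
      LipschitzOnWith (1 / 2) (weightedPicard hT hb hf hv x₀ l) (closedBall 0 (2 * η)) := by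
    refine LipschitzOnWith.of_dist_le_mul fun z hz z' hz' => ?_
    refine (dist_weightedPicard_le L.coe_nonneg hl fun s hs =>
      (hlip s hs).norm_sub_le (htube hz hs) (htube hz' hs)).trans ?_
    gcongr
    rw [div_le_iff₀ hl, NNReal.coe_div, NNReal.coe_one, NNReal.coe_ofNat]
    simp only [l]
    linarith
  have hzero : dist (weightedPicard hT hb hf hv x₀ l 0) 0 ≤ (1 - (1 / 2 : ℝ≥0)) * (2 * η) := by
    rw [dist_zero_right]
    refine (norm_weightedPicard_zero_le hl.le hdefect).trans_eq ?_
    rw [NNReal.coe_div, NNReal.coe_one, NNReal.coe_ofNat]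
    ring
  obtain ⟨z, hz, hfix⟩ := exists_isFixedPt_of_lipschitzOnWith_closedBall
    (by norm_num) (by positivity) hcontr hzero
  exact ⟨_, isCaratheodorySolution_of_isFixedPt_weightedPicard hfix, fun t ht => htube hz ht⟩

end Picard

section Averaging

theorem eventually_const_mul_lt (c : ℝ) {ε : ℝ} (hε : 0 < ε) :
    ∀ᶠ h in 𝓝[>] (0 : ℝ), c * h < ε := by
  have hlim : Tendsto (fun h : ℝ => c * h) (𝓝[>] 0) (𝓝 0) := by
    simpa using (continuous_const_mul c).continuousWithinAt (s := Ioi 0) (x := (0 : ℝ)) |>.tendsto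
  exact hlim.eventually_lt_const hε

theorem eventually_norm_integral_smul_comp_primitive_sub_le [CompleteSpace E] {M T η : ℝ}
    {G : ℝ → ℝ → E} (hM : 0 ≤ M) (hT : 0 ≤ T) (hη : 0 < η)
    (hG : ContinuousOn (fun p : ℝ × ℝ => G p.1 p.2) (Icc (-1) (T + 1) ×ˢ Icc 0 T)) :
    ∀ᶠ h in 𝓝[>] (0 : ℝ), ∀ a b : ℝ → ℝ, IsSplittingCoefficient h a → EssBoundedBy M a →
      IsSplittingCoefficient h b → EssBoundedBy M b → ∀ t ∈ Icc 0 T,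
        ‖(∫ s in (0 : ℝ)..t, b s • G (∫ r in (0 : ℝ)..s, a r) s) -
          ∫ s in (0 : ℝ)..t, G s s‖ ≤ η := by
  have hcomp : IsCompact (Icc (-1) (T + 1) ×ˢ Icc 0 T) := isCompact_Icc.prod isCompact_Icc
  obtain ⟨g, hg⟩ := hcomp.exists_bound_of_continuousOn hG
  set ω : ℝ := η / 2 / ((2 * M + 1) * T + 1)
  have hω : 0 < ω := by positivity
  have hωη : (2 * M + 1) * ω * T ≤ η / 2 := by
    rw [mul_right_comm, mul_div_assoc', div_le_iff₀ (by positivity)]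
    linarith
  obtain ⟨δ, hδ, hunif⟩ :=
    Metric.uniformContinuousOn_iff.1 (hcomp.uniformContinuousOn_of_continuous hG) ω hω
  filter_upwards [self_mem_nhdsWithin, eventually_const_mul_lt (M + 1) hδ,
    eventually_const_mul_lt (M + 1) one_pos,
    eventually_const_mul_lt ((M + 1) * g) (half_pos hη)]
    with h hh hhδ hh₁ hhg a b ha haM hb hbM t ht
  refine (ha.norm_integral_smul_comp_primitive_sub_le haM hb hbM hh hh₁.le ht hG
    (fun τ hτ s hs => hg (τ, s) ⟨hτ, hs⟩) (ω := ω) fun τ hτ τ' hτ' s hs s' hs' hττ hss => ?_).trans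
    (by linarith)
  rw [← dist_eq_norm]
  exact (hunif (τ, s) ⟨hτ, hs⟩ (τ', s') ⟨hτ', hs'⟩
    (max_lt (hττ.trans_lt hhδ) (hss.trans_lt hhδ))).le

variable {M T ε : ℝ} {f : ℝ → E → E} {v w : ℝ → E} {x₀ : E}

theorem eventually_exists_isCaratheodorySolution_mem_closedBall [CompleteSpace E] {L : ℝ≥0}
    (hM : 0 ≤ M) (hT : 0 ≤ T) (hε : 0 < ε) (hf : Continuous fun p : ℝ × E => f p.1 p.2)
    (hv : IsCaratheodorySolution f x₀ T v)
    (hlip : ∀ τ ∈ Icc (-1) (T + 1), ∀ s ∈ Icc 0 T, LipschitzOnWith L (f τ) (closedBall (v s) ε)) :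
    ∀ᶠ h in 𝓝[>] (0 : ℝ), ∀ a b : ℝ → ℝ, IsSplittingCoefficient h a → EssBoundedBy M a →
      IsSplittingCoefficient h b → EssBoundedBy M b →
        ∃ w, IsCaratheodorySolution (fun s x => b s • f (∫ r in (0 : ℝ)..s, a r) x) x₀ T w ∧
          ∀ t ∈ Icc 0 T, w t ∈ closedBall (v t) ε := by
  set η : ℝ := ε / (2 * Real.exp ((2 * M * L + 1) * T)) with hη
  have hG : ContinuousOn (fun p : ℝ × ℝ => f p.1 (v p.2)) (Icc (-1) (T + 1) ×ˢ Icc 0 T) :=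
    hf.comp_continuousOn (continuousOn_fst.prodMk
      (hv.1.comp continuousOn_snd fun _ hp => hp.2))
  filter_upwards [self_mem_nhdsWithin, eventually_const_mul_lt (M + 1) one_pos,
    eventually_norm_integral_smul_comp_primitive_sub_le (G := fun τ s => f τ (v s)) (η := η)
      hM hT (by positivity) hG]
    with h hh hh₁ hdefect a b ha haM hb hbM
  refine exists_isCaratheodorySolution_of_defect_le (η := η) hT hbM
    (hf.comp ((haM.continuous_primitive.comp continuous_fst).prodMk continuous_snd)) hv.1
    (fun s hs => hlip _ (ha.integral_mem_Icc haM hh hh₁.le hs) s hs) (fun t ht => ?_) ?_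
  · rw [hv.2 t ht, add_sub_add_left_eq_sub]
    exact hdefect a b ha haM hb hbM t ht
  · rw [hη]
    exact (by field_simp : _ = ε).le

variable {F : Type*} [NormedAddCommGroup F] [NormedSpace ℝ F] [CompleteSpace E] [CompleteSpace F]

theorem IsCaratheodorySolution.map_eq {g : ℝ → E → E} (hw : IsCaratheodorySolution g x₀ T w)
    (J : E →L[ℝ] F) {t : ℝ} (ht : t ∈ Icc 0 T)
    (hint : IntervalIntegrable (fun s => g s (w s)) volume 0 t) :
    J (w t) = J x₀ + ∫ s in (0 : ℝ)..t, J (g s (w s)) := by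
  rw [hw.2 t ht, map_add, ← J.intervalIntegral_comp_comm hint]

theorem IsCaratheodorySolution.norm_map_sub_le (hf : Continuous fun p : ℝ × E => f p.1 p.2)
    (hv : IsCaratheodorySolution f x₀ T v) (J : E →L[ℝ] F) {g : ℝ}
    (hg : ∀ s ∈ Icc 0 T, ‖J (f s (v s))‖ ≤ g) {s t : ℝ} (hs : s ∈ Icc 0 T) (ht : t ∈ Icc 0 T) :
    ‖J (v t) - J (v s)‖ ≤ g * |t - s| := by
  have hfv : ContinuousOn (fun s => f s (v s)) (Icc 0 T) :=
    hf.comp_continuousOn (continuousOn_id.prodMk hv.1)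
  have hint {s t : ℝ} (hs : s ∈ Icc 0 T) (ht : t ∈ Icc 0 T) :
      IntervalIntegrable (fun s => f s (v s)) volume s t :=
    (hfv.mono (uIcc_subset_Icc hs ht)).intervalIntegrable
  have h0 : (0 : ℝ) ∈ Icc 0 T := ⟨le_rfl, hs.1.trans hs.2⟩
  rw [← map_sub, hv.2 t ht, hv.2 s hs, add_sub_add_left_eq_sub,
    intervalIntegral.integral_interval_sub_left (hint h0 ht) (hint h0 hs),
    ← J.intervalIntegral_comp_comm (hint hs ht)]
  exact intervalIntegral.norm_integral_le_of_norm_le_const fun r hr =>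
    hg r (uIcc_subset_Icc hs ht (uIoc_subset_uIcc hr))

theorem IsCaratheodorySolution.norm_map_apply_sub_le {Λ : ℝ≥0} {Λ' g τ τ' s s' : ℝ}
    (hf : Continuous fun p : ℝ × E => f p.1 p.2) (hv : IsCaratheodorySolution f x₀ T v)
    (J : E →L[ℝ] F) (hg : ∀ r ∈ Icc 0 T, ‖J (f r (v r))‖ ≤ g)
    (hspace : ∀ r ∈ Icc 0 T, ∀ r' ∈ Icc 0 T,
      ‖J (f τ' (v r)) - J (f τ' (v r'))‖ ≤ Λ * ‖J (v r) - J (v r')‖)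
    (htime : ‖J (f τ (v s)) - J (f τ' (v s))‖ ≤ Λ' * |τ - τ'|) (hs : s ∈ Icc 0 T)
    (hs' : s' ∈ Icc 0 T) :
    ‖J (f τ (v s)) - J (f τ' (v s'))‖ ≤ max Λ' (Λ * g) * (|τ - τ'| + |s - s'|) :=
  calc _ ≤ Λ' * |τ - τ'| + Λ * (g * |s - s'|) :=
        (norm_sub_le_norm_sub_add_norm_sub _ _ _).trans <| add_le_add htime <|
          (hspace s hs s' hs').trans <|
            mul_le_mul_of_nonneg_left (hv.norm_map_sub_le hf J hg hs' hs) Λ.coe_nonneg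
    _ ≤ max Λ' (Λ * g) * |τ - τ'| + max Λ' (Λ * g) * |s - s'| := by
        rw [← mul_assoc]
        gcongr
        exacts [le_max_left _ _, le_max_right _ _]
    _ = max Λ' (Λ * g) * (|τ - τ'| + |s - s'|) := (mul_add _ _ _).symm

/-- Only the norm of `F` enters: there `f` is Lipschitz in time along `v`, although in `E` it is
merely continuous. -/
theorem IsCaratheodorySolution.norm_map_sub_le_mul_exp {a b : ℝ → ℝ} {h g Λ' : ℝ} {Λ : ℝ≥0}
    (ha : IsSplittingCoefficient h a) (haM : EssBoundedBy M a) (hb : IsSplittingCoefficient h b)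
    (hbM : EssBoundedBy M b) (hh : 0 < h) (hh₁ : (M + 1) * h ≤ 1)
    (hΛ' : 0 ≤ Λ') (hf : Continuous fun p : ℝ × E => f p.1 p.2)
    (hv : IsCaratheodorySolution f x₀ T v)
    (hw : IsCaratheodorySolution (fun s x => b s • f (∫ r in (0 : ℝ)..s, a r) x) x₀ T w)
    (J : E →L[ℝ] F) (hg : ∀ τ ∈ Icc (-1) (T + 1), ∀ s ∈ Icc 0 T, ‖J (f τ (v s))‖ ≤ g)
    (hspace : ∀ τ, ∀ s ∈ Icc 0 T, ‖J (f τ (w s)) - J (f τ (v s))‖ ≤ Λ * ‖J (w s) - J (v s)‖)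
    (hosc : ∀ τ ∈ Icc (-1) (T + 1), ∀ τ' ∈ Icc (-1) (T + 1), ∀ s ∈ Icc 0 T, ∀ s' ∈ Icc 0 T,
      ‖J (f τ (v s)) - J (f τ' (v s'))‖ ≤ Λ' * (|τ - τ'| + |s - s'|)) {t : ℝ} (ht : t ∈ Icc 0 T) :
    ‖J (w t) - J (v t)‖ ≤
      ((2 * M + 1) * (Λ' * (2 * (M + 1))) * T + (M + 1) * g) * Real.exp (M * Λ * t) * h := by
  have hT : 0 ≤ T := ht.1.trans ht.2
  set φ : ℝ → ℝ := fun s => ∫ r in (0 : ℝ)..s, a r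
  have hφ : Continuous φ := haM.continuous_primitive
  have hfφ {u : ℝ → E} (hu : ContinuousOn u (Icc 0 T)) :
      ContinuousOn (fun s => f (φ s) (u s)) (Icc 0 T) :=
    hf.comp_continuousOn (hφ.continuousOn.prodMk hu)
  have hJ {u : ℝ → E} (hu : ContinuousOn u (Icc 0 T)) : ContinuousOn (fun s => J (u s)) (Icc 0 T) :=
    J.continuous.comp_continuousOn hu
  have hG : ContinuousOn (fun p : ℝ × ℝ => J (f p.1 (v p.2))) (Icc (-1) (T + 1) ×ˢ Icc 0 T) :=
    J.continuous.comp_continuousOn (hf.comp_continuousOn (continuousOn_fst.prodMk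
      (hv.1.comp continuousOn_snd fun _ hp => hp.2)))
  have hsub {t : ℝ} (ht : t ∈ Icc 0 T) : uIcc 0 t ⊆ Icc 0 T := uIcc_subset_Icc ⟨le_rfl, hT⟩ ht
  have hdefect {t : ℝ} (ht : t ∈ Icc 0 T) :=
    ha.norm_integral_smul_comp_primitive_sub_le (G := fun τ s => J (f τ (v s)))
      (ω := Λ' * (2 * (M + 1)) * h) haM hb hbM hh hh₁ ht hG hg
      fun τ hτ τ' hτ' s hs s' hs' hττ hss => (hosc τ hτ τ' hτ' s hs s' hs').trans <| by
        rw [mul_assoc]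
        gcongr
        linarith
  refine (hbM.norm_sub_le_mul_exp (x₀ := J x₀) Λ.coe_nonneg (hJ hw.1) (hJ hv.1) (hJ (hfφ hw.1))
    (hJ (hfφ hv.1)) (fun t ht => ?_) (fun t ht => ?_) (fun s hs => hspace (φ s) s hs)
    (fun t ht => hdefect ht) ht).trans_eq (by ring)
  · simp only [hw.map_eq J ht (hbM.intervalIntegrable_smul ((hfφ hw.1).mono (hsub ht))),
      map_smul, φ]
  · exact hv.map_eq J ht ((hf.comp_continuousOn (continuousOn_id.prodMk hv.1)).mono
      (hsub ht)).intervalIntegrable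

theorem IsCaratheodorySolution.exists_forall_eventually_norm_map_sub_le {L Λ Λ' : ℝ≥0} {R : ℝ}
    (hM : 0 ≤ M) (hT : 0 ≤ T) (hε : 0 < ε) (hf : Continuous fun p : ℝ × E => f p.1 p.2)
    (hv : IsCaratheodorySolution f x₀ T v) (hR : ∀ s ∈ Icc 0 T, ‖v s‖ + ε ≤ R)
    (hlip : ∀ τ ∈ Icc (-1) (T + 1), ∀ s ∈ Icc 0 T, LipschitzOnWith L (f τ) (closedBall (v s) ε))
    (J : E →L[ℝ] F) (hspace : ∀ τ x y, ‖x‖ ≤ R → ‖y‖ ≤ R →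
      ‖J (f τ x) - J (f τ y)‖ ≤ Λ * ‖J x - J y‖)
    (htime : ∀ τ ∈ Icc (-1) (T + 1), ∀ τ' ∈ Icc (-1) (T + 1), ∀ s ∈ Icc 0 T,
      ‖J (f τ (v s)) - J (f τ' (v s))‖ ≤ Λ' * |τ - τ'|) :
    ∃ C > 0, ∀ᶠ h in 𝓝[>] (0 : ℝ), ∀ a b : ℝ → ℝ, IsSplittingCoefficient h a → EssBoundedBy M a →
      IsSplittingCoefficient h b → EssBoundedBy M b →
        ∃ w, IsCaratheodorySolution (fun s x => b s • f (∫ r in (0 : ℝ)..s, a r) x) x₀ T w ∧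
          ∀ t ∈ Icc 0 T, ‖J (w t) - J (v t)‖ ≤ C * h := by
  obtain ⟨g, hg⟩ := (isCompact_Icc.prod isCompact_Icc).exists_bound_of_continuousOn
    (J.continuous.comp_continuousOn (hf.comp_continuousOn (continuousOn_fst.prodMk
      (hv.1.comp continuousOn_snd fun (_ : ℝ × ℝ) (hp : _ ∈ Icc (-1) (T + 1) ×ˢ Icc 0 T) => hp.2))))
  replace hg (τ : ℝ) (hτ : τ ∈ Icc (-1) (T + 1)) (s : ℝ) (hs : s ∈ Icc 0 T) :
      ‖J (f τ (v s))‖ ≤ g := hg (τ, s) ⟨hτ, hs⟩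
  have hIcc {s : ℝ} (hs : s ∈ Icc 0 T) : s ∈ Icc (-1) (T + 1) :=
    ⟨by linarith [hs.1], by linarith [hs.2]⟩
  have hg₀ : 0 ≤ g := (norm_nonneg _).trans (hg 0 (hIcc ⟨le_rfl, hT⟩) 0 ⟨le_rfl, hT⟩)
  have hvR {s : ℝ} (hs : s ∈ Icc 0 T) : ‖v s‖ ≤ R := by linarith [hR s hs]
  set Λ'' : ℝ := max Λ' (Λ * g)
  have hΛ'' : 0 ≤ Λ'' := le_max_of_le_left Λ'.coe_nonneg
  refine ⟨((2 * M + 1) * (Λ'' * (2 * (M + 1))) * T + (M + 1) * g) * Real.exp (M * Λ * T) + 1,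
    by positivity, ?_⟩
  filter_upwards [self_mem_nhdsWithin, eventually_const_mul_lt (M + 1) one_pos,
    eventually_exists_isCaratheodorySolution_mem_closedBall hM hT hε hf hv hlip]
    with h (hh : 0 < h) hh₁ hex a b ha haM hb hbM
  obtain ⟨w, hw, hwv⟩ := hex a b ha haM hb hbM
  have hwR {s : ℝ} (hs : s ∈ Icc 0 T) : ‖w s‖ ≤ R :=
    (norm_le_of_mem_closedBall (hwv s hs)).trans (hR s hs)
  refine ⟨w, hw, fun t ht => (hv.norm_map_sub_le_mul_exp ha haM hb hbM hh hh₁.le hΛ'' hf hw J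
    hg (fun τ s hs => hspace τ _ _ (hwR hs) (hvR hs))
    (fun τ hτ τ' hτ' s hs s' hs' => hv.norm_map_apply_sub_le hf J (fun r hr => hg r (hIcc hr) r hr)
      (fun r hr r' hr' => hspace _ _ _ (hvR hr) (hvR hr')) (htime τ hτ τ' hτ' s hs) hs hs')
    ht).trans ?_⟩
  gcongr
  refine le_add_of_le_of_nonneg ?_ zero_le_one
  gcongr
  exact ht.2

end Averaging

end Caratheodory

section InteractionPicture

variable {H : Type*} [NormedAddCommGroup H] [InnerProductSpace ℂ H]

/-- The vector field of the interaction picture: in terms of `w t = U (-∫₀ᵗ a) (u t)`, where `U` is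
the unitary group of `A`, the equation `u' = -i (a(t) A + b(t) B) u` is `w' = b(t) F(∫₀ᵗ a, w)`. -/
noncomputable def interactionField (U : ℝ → H ≃ₗᵢ[ℂ] H) (B : H → H) (τ : ℝ) (x : H) : H :=
  -(Complex.I • U (-τ) (B (U τ x)))

theorem norm_interactionField_sub (U : ℝ → H ≃ₗᵢ[ℂ] H) (B : H → H) (τ : ℝ) (x y : H) :
    ‖interactionField U B τ x - interactionField U B τ y‖ = ‖B (U τ x) - B (U τ y)‖ := by
  rw [interactionField, interactionField, neg_sub_neg, ← smul_sub, ← map_sub, norm_smul,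
    Complex.norm_I, one_mul, LinearIsometryEquiv.norm_map, norm_sub_rev]

theorem continuous_interactionField {U : ℝ → H ≃ₗᵢ[ℂ] H} (hU : IsContinuousUnitaryGroup U)
    {B : H → H} (hB : Continuous B) : Continuous fun p : ℝ × H => interactionField U B p.1 p.2 := by
  have h := hU.continuous_uncurry
  exact ((h.comp (continuous_fst.neg.prodMk (hB.comp h))).const_smul Complex.I).neg

theorem exists_lipschitzOnWith_interactionField {U : ℝ → H ≃ₗᵢ[ℂ] H}
    (hU : IsContinuousUnitaryGroup U) {B : H → H} (hB : LocallyLipschitz B) {S : Set ℝ}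
    (hS : IsCompact S) {k : Set H} (hk : IsCompact k) :
    ∃ ε > 0, ∃ L : ℝ≥0, ∀ τ ∈ S, ∀ x ∈ k,
      LipschitzOnWith L (interactionField U B τ) (closedBall x ε) := by
  obtain ⟨ε, hε, L, hL⟩ :=
    exists_lipschitzOnWith_closedBall_of_isCompact hB ((hS.prod hk).image hU.continuous_uncurry)
  refine ⟨ε, hε, L, fun τ hτ x hx => LipschitzOnWith.of_dist_le_mul fun y hy z hz => ?_⟩
  have hmem {y : H} (hy : y ∈ closedBall x ε) : U τ y ∈ closedBall (U τ x) ε := by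
    rwa [mem_closedBall, LinearIsometryEquiv.dist_map]
  rw [dist_eq_norm, norm_interactionField_sub, ← dist_eq_norm, ← (U τ).dist_map y z]
  exact (hL _ (mem_image_of_mem _ (mk_mem_prod hτ hx))).dist_le_mul _ (hmem hy) _ (hmem hz)

theorem propagator_apply (A : H →ₗ.[ℂ] H) {M : ℝ} {a : ℝ → ℝ} (ha : EssBoundedBy M a) (s t : ℝ)
    (x : H) : propagator A a t s x =
      unitaryGroup A (∫ r in (0 : ℝ)..t, a r) (unitaryGroup A (-∫ r in (0 : ℝ)..s, a r) x) := by
  rw [propagator, ← (isContinuousUnitaryGroup_unitaryGroup A).map_add, ← sub_eq_add_neg,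
    intervalIntegral.integral_interval_sub_left (ha.intervalIntegrable _ _)
      (ha.intervalIntegrable _ _)]

theorem neg_I_smul_integral_smul_propagator [CompleteSpace H] (A : H →ₗ.[ℂ] H) (B : H → H) {M : ℝ}
    {a : ℝ → ℝ} (ha : EssBoundedBy M a) (b : ℝ → ℝ) (u : ℝ → H) (t : ℝ) :
    -(Complex.I • ∫ s in (0 : ℝ)..t, b s • propagator A a t s (B (u s))) =
      unitaryGroup A (∫ r in (0 : ℝ)..t, a r) (∫ s in (0 : ℝ)..t,
        b s • interactionField (unitaryGroup A) B (∫ r in (0 : ℝ)..s, a r)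
          (unitaryGroup A (-∫ r in (0 : ℝ)..s, a r) (u s))) := by
  have hU := isContinuousUnitaryGroup_unitaryGroup A
  set V := unitaryGroup A (∫ r in (0 : ℝ)..t, a r)
  rw [← V.coe_toLinearIsometry, ← LinearIsometry.intervalIntegral_comp_comm,
    ← intervalIntegral.integral_smul, ← intervalIntegral.integral_neg]
  congr 1 with s
  rw [propagator_apply A ha, interactionField, hU.apply_neg_apply, V.coe_toLinearIsometry,
    map_real_smul V V.continuous, map_neg, map_smul, smul_neg, smul_comm]

theorem isSplitSolution_iff_isCaratheodorySolution [CompleteSpace H] {A : H →ₗ.[ℂ] H} {B : H → H}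
    {M T : ℝ} {a b : ℝ → ℝ} {u₀ : H} {u : ℝ → H} (ha : EssBoundedBy M a) :
    IsSplitSolution A B a b u₀ T u ↔ IsCaratheodorySolution
      (fun s x => b s • interactionField (unitaryGroup A) B (∫ r in (0 : ℝ)..s, a r) x) u₀ T
      (fun t => unitaryGroup A (-∫ r in (0 : ℝ)..t, a r) (u t)) := by
  have hU := isContinuousUnitaryGroup_unitaryGroup A
  have hφ : ContinuousOn (fun t => ∫ r in (0 : ℝ)..t, a r) (Icc 0 T) :=
    ha.continuous_primitive.continuousOn
  refine and_congr ⟨hU.continuousOn_apply hφ.neg, fun h => ?_⟩ (forall₂_congr fun t _ => ?_)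
  · simpa only [hU.apply_neg_apply] using hU.continuousOn_apply hφ h
  · beta_reduce
    rw [sub_eq_add_neg, neg_I_smul_integral_smul_propagator A B ha, propagator_apply A ha,
      intervalIntegral.integral_same, neg_zero, hU.map_zero, ← map_add]
    constructor
    · intro h
      rw [h, hU.neg_apply_apply]
    · intro h
      rw [← h, hU.apply_neg_apply]

theorem isMildSolution_iff_isSplitSolution_one {A : H →ₗ.[ℂ] H} {B : H → H} {u₀ : H} {T : ℝ}
    {u : ℝ → H} :
    IsMildSolution A B u₀ T u ↔ IsSplitSolution A B (fun _ => 1) (fun _ => 1) u₀ T u := by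
  simp [IsMildSolution, IsSplitSolution, propagator]

theorem IsMildSolution.isCaratheodorySolution [CompleteSpace H] {A : H →ₗ.[ℂ] H} {B : H → H}
    {u₀ : H} {T : ℝ} {u : ℝ → H} (hu : IsMildSolution A B u₀ T u) :
    IsCaratheodorySolution (interactionField (unitaryGroup A) B) u₀ T
      (fun t => unitaryGroup A (-t) (u t)) := by
  simpa using (isSplitSolution_iff_isCaratheodorySolution EssBoundedBy.one).1
    (isMildSolution_iff_isSplitSolution_one.1 hu)

theorem exactFlow_eq_splitFlow (A : H →ₗ.[ℂ] H) (B : H → H) (t : ℝ) (u₀ : H) :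
    exactFlow A B t u₀ = splitFlow A B (fun _ => 1) (fun _ => 1) t u₀ := by
  have h : IsMildSolution A B u₀ t = IsSplitSolution A B (fun _ => 1) (fun _ => 1) u₀ t :=
    funext fun _ => propext isMildSolution_iff_isSplitSolution_one
  unfold exactFlow splitFlow
  rw [h]

namespace IsSplitSolution

variable {A : H →ₗ.[ℂ] H} {B : H → H} {a b : ℝ → ℝ} {u₀ : H} {M N S T : ℝ} {u w : ℝ → H}

theorem mono (h : IsSplitSolution A B a b u₀ T u) (hST : S ≤ T) :
    IsSplitSolution A B a b u₀ S u :=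
  ⟨h.1.mono (Icc_subset_Icc_right hST), fun t ht => h.2 t (Icc_subset_Icc_right hST ht)⟩

protected theorem eqOn [CompleteSpace H] (hB : LocallyLipschitz B) (ha : EssBoundedBy M a)
    (hb : EssBoundedBy N b) (hu : IsSplitSolution A B a b u₀ T u)
    (hw : IsSplitSolution A B a b u₀ T w) : EqOn u w (Icc 0 T) := by
  have hU := isContinuousUnitaryGroup_unitaryGroup A
  set φ : ℝ → ℝ := fun t => ∫ r in (0 : ℝ)..t, a r
  have hu' := (isSplitSolution_iff_isCaratheodorySolution ha).1 hu
  have hw' := (isSplitSolution_iff_isCaratheodorySolution ha).1 hw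
  have hfield {x : ℝ → H} (hx : ContinuousOn x (Icc 0 T)) :
      ContinuousOn (fun s => interactionField (unitaryGroup A) B (φ s) (x s)) (Icc 0 T) :=
    (continuous_interactionField hU hB.continuous).comp_continuousOn
      (ha.continuous_primitive.continuousOn.prodMk hx)
  obtain ⟨L, hL⟩ := (hB.locallyLipschitzOn (s := u '' Icc 0 T ∪ w '' Icc 0 T)
    ).exists_lipschitzOnWith_of_compact
      ((isCompact_Icc.image_of_continuousOn hu.1).union (isCompact_Icc.image_of_continuousOn hw.1))
  intro t ht
  have hdist := hb.norm_sub_le_mul_exp (D := 0) L.coe_nonneg hu'.1 hw'.1 (hfield hu'.1)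
    (hfield hw'.1) hu'.2 hw'.2 (fun s hs => ?_) (fun s _ => (norm_eq_zero.2 (sub_self _)).le) ht
  · rw [zero_mul, norm_le_zero_iff, sub_eq_zero] at hdist
    exact (unitaryGroup A (-φ t)).injective hdist
  · rw [norm_interactionField_sub, hU.apply_neg_apply, hU.apply_neg_apply, ← map_sub,
      LinearIsometryEquiv.norm_map]
    exact hL.norm_sub_le (Or.inl (mem_image_of_mem _ hs)) (Or.inr (mem_image_of_mem _ hs))

theorem splitFlow_eq [CompleteSpace H] (hB : LocallyLipschitz B) (ha : EssBoundedBy M a)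
    (hb : EssBoundedBy N b) (hu : IsSplitSolution A B a b u₀ T u) {t : ℝ} (ht : t ∈ Icc 0 T) :
    splitFlow A B a b t u₀ = u t := by
  have h : ∃ u : ℝ → H, IsSplitSolution A B a b u₀ t u := ⟨u, hu.mono ht.2⟩
  rw [splitFlow, dif_pos h]
  exact h.choose_spec.eqOn hB ha hb (hu.mono ht.2) ⟨ht.1, le_rfl⟩

end IsSplitSolution

theorem IsMildSolution.exactFlow_eq [CompleteSpace H] {A : H →ₗ.[ℂ] H} {B : H → H} {u₀ : H}
    {T : ℝ} {u : ℝ → H} (hB : LocallyLipschitz B) (hu : IsMildSolution A B u₀ T u) {t : ℝ}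
    (ht : t ∈ Icc 0 T) : exactFlow A B t u₀ = u t := by
  rw [exactFlow_eq_splitFlow]
  exact (isMildSolution_iff_isSplitSolution_one.1 hu).splitFlow_eq hB .one .one ht

theorem exists_isMildSolution_of_lt_maximalTime {A : H →ₗ.[ℂ] H} {B : H → H} {u₀ : H} {T : ℝ}
    (hT : ENNReal.ofReal T < maximalTime A B u₀) : ∃ u : ℝ → H, IsMildSolution A B u₀ T u := by
  obtain ⟨_, ⟨S, -, rfl, u, hu⟩, hTS⟩ := lt_sSup_iff.1 hT
  have hTS : T ≤ S := (ENNReal.ofReal_lt_ofReal_iff'.1 hTS).1.le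
  exact ⟨u, hu.1.mono (Icc_subset_Icc_right hTS), fun t ht => hu.2 t (Icc_subset_Icc_right hTS ht)⟩

end InteractionPicture

section GlobalError

variable {H₁ H₀ : Type*} [NormedAddCommGroup H₁] [InnerProductSpace ℂ H₁]
  [NormedAddCommGroup H₀] [InnerProductSpace ℂ H₀]
  {J : H₁ →L[ℂ] H₀} {U : ℝ → H₁ ≃ₗᵢ[ℂ] H₁} {K : ℝ≥0} {B : H₁ → H₁}

theorem IsWeaklyLipschitzGroup.norm_map_apply_sub_apply_le (hJ : IsWeaklyLipschitzGroup J U K)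
    (s t : ℝ) (x y : H₁) :
    ‖J (U t x) - J (U s y)‖ ≤ K * |t - s| * ‖x‖ + ‖J x - J y‖ := by
  have hspace : ‖J (U s x) - J (U s y)‖ = ‖J x - J y‖ := by
    rw [← map_sub, ← map_sub, hJ.norm_map, map_sub]
  exact (norm_sub_le_norm_sub_add_norm_sub _ _ _).trans
    (add_le_add (hJ.norm_map_sub_le s t x) hspace.le)

theorem IsWeaklyLipschitzGroup.norm_map_interactionField_sub_le (hJ : IsWeaklyLipschitzGroup J U K)
    {Λ : ℝ≥0} {R : ℝ} {x y : H₁} (hx : ‖x‖ ≤ R) (hy : ‖y‖ ≤ R)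
    (hΛ : ∀ x y, ‖x‖ ≤ R → ‖y‖ ≤ R → ‖J (B x) - J (B y)‖ ≤ Λ * ‖J (x - y)‖) (τ τ' : ℝ) :
    ‖J (interactionField U B τ x) - J (interactionField U B τ' y)‖ ≤
      (K * ‖B (U τ x)‖ + Λ * (K * R)) * |τ - τ'| + Λ * ‖J x - J y‖ := by
  have hBU : ‖J (B (U τ x)) - J (B (U τ' y))‖ ≤ Λ * (K * |τ - τ'| * R + ‖J x - J y‖) := by
    refine (hΛ _ _ (by rwa [LinearIsometryEquiv.norm_map])
      (by rwa [LinearIsometryEquiv.norm_map])).trans ?_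
    rw [map_sub]
    gcongr
    exact (hJ.norm_map_apply_sub_apply_le _ _ _ _).trans (by gcongr)
  calc ‖J (interactionField U B τ x) - J (interactionField U B τ' y)‖
      = ‖J (U (-τ) (B (U τ x))) - J (U (-τ') (B (U τ' y)))‖ := by
        rw [interactionField, interactionField, ← map_sub, neg_sub_neg, ← smul_sub, map_smul,
          norm_smul, Complex.norm_I, one_mul, map_sub, norm_sub_rev]
    _ ≤ K * |τ - τ'| * ‖B (U τ x)‖ + Λ * (K * |τ - τ'| * R + ‖J x - J y‖) := by
        have hle := hJ.norm_map_apply_sub_apply_le (-τ') (-τ) (B (U τ x)) (B (U τ' y))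
        rw [neg_sub_neg, abs_sub_comm] at hle
        exact hle.trans (by gcongr)
    _ = (K * ‖B (U τ x)‖ + Λ * (K * R)) * |τ - τ'| + Λ * ‖J x - J y‖ := by ring

theorem IsWeaklyLipschitzGroup.exists_lipschitz_time_interactionField
    (hJ : IsWeaklyLipschitzGroup J U K) (hU : IsContinuousUnitaryGroup U) (hB : Continuous B)
    (hBJ : IsWeaklyLipschitzOnBounded J B) {S : Set ℝ} (hS : IsCompact S) {k : Set H₁}
    (hk : IsCompact k) :
    ∃ Λ : ℝ≥0, ∀ τ ∈ S, ∀ τ', ∀ x ∈ k,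
      ‖J (interactionField U B τ x) - J (interactionField U B τ' x)‖ ≤ Λ * |τ - τ'| := by
  obtain ⟨R, hR⟩ := hk.exists_bound_of_continuousOn continuousOn_id
  obtain ⟨g, hg⟩ := (hS.prod hk).exists_bound_of_continuousOn
    (hB.comp hU.continuous_uncurry).continuousOn
  obtain ⟨Λ, hΛ⟩ := hBJ R
  refine ⟨(K * g + Λ * (K * R)).toNNReal, fun τ hτ τ' x hx => ?_⟩
  have hle := hJ.norm_map_interactionField_sub_le (x := x) (y := x) (hR x hx) (hR x hx) hΛ τ τ'
  rw [sub_self (J x), norm_zero, mul_zero, add_zero] at hle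
  refine hle.trans (mul_le_mul_of_nonneg_right ?_ (abs_nonneg _))
  refine (?_ : _ ≤ K * g + Λ * (K * R)).trans (Real.le_coe_toNNReal _)
  gcongr
  exact hg (τ, x) ⟨hτ, hx⟩

theorem IsMildSolution.exists_forall_eventually_norm_map_sub_le [CompleteSpace H₁]
    [CompleteSpace H₀] {A : H₁ →ₗ.[ℂ] H₁} {u₀ : H₁} {M T : ℝ} {u : ℝ → H₁}
    (hu : IsMildSolution A B u₀ T u) (hM : 0 ≤ M) (hT : 0 ≤ T)
    (hJ : IsWeaklyLipschitzGroup J (unitaryGroup A) K) (hB : LocallyLipschitz B)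
    (hBJ : IsWeaklyLipschitzOnBounded J B) :
    ∃ C > 0, ∀ᶠ h in 𝓝[>] (0 : ℝ), ∀ a b : ℝ → ℝ, IsSplittingCoefficient h a → EssBoundedBy M a →
      IsSplittingCoefficient h b → EssBoundedBy M b →
        ∃ v, IsSplitSolution A B a b u₀ T v ∧ ∀ t ∈ Icc 0 T, ‖J (u t) - J (v t)‖ ≤ C * h := by
  have hU := isContinuousUnitaryGroup_unitaryGroup A
  have hy := hu.isCaratheodorySolution
  set U := unitaryGroup A
  set y : ℝ → H₁ := fun t => U (-t) (u t)
  have hcomp : IsCompact (y '' Icc 0 T) := isCompact_Icc.image_of_continuousOn hy.1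
  obtain ⟨ε, hε, L, hL⟩ := exists_lipschitzOnWith_interactionField hU hB isCompact_Icc hcomp
  obtain ⟨Λ', hΛ'⟩ :=
    hJ.exists_lipschitz_time_interactionField hU hB.continuous hBJ isCompact_Icc hcomp
  obtain ⟨r, hr⟩ := isCompact_Icc.exists_bound_of_continuousOn hy.1
  obtain ⟨Λ, hΛ⟩ := hBJ (r + ε)
  obtain ⟨C, hC, hav⟩ := hy.exists_forall_eventually_norm_map_sub_le (M := M) (R := r + ε) hM hT hε
    (continuous_interactionField hU hB.continuous) (fun s hs => by gcongr; exact hr s hs)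
    (fun τ hτ s hs => hL τ hτ _ (mem_image_of_mem y hs)) (J.restrictScalars ℝ)
    (fun τ x z hx hz => by simpa using hJ.norm_map_interactionField_sub_le hx hz hΛ τ τ)
    (fun τ hτ τ' _ s hs => hΛ' τ hτ τ' _ (mem_image_of_mem y hs))
  have hr₀ : 0 ≤ r := (norm_nonneg _).trans (hr 0 ⟨le_rfl, hT⟩)
  refine ⟨K * (M + 1) * r + C, by positivity, ?_⟩
  filter_upwards [self_mem_nhdsWithin, hav] with h (hh : 0 < h) hav a b ha haM hb hbM
  obtain ⟨w, hw, hwy⟩ := hav a b ha haM hb hbM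
  set φ : ℝ → ℝ := fun t => ∫ s in (0 : ℝ)..t, a s
  refine ⟨fun t => U (φ t) (w t), (isSplitSolution_iff_isCaratheodorySolution haM).2 ?_,
    fun t ht => ?_⟩
  · convert hw using 2 with t
    exact hU.neg_apply_apply _ _
  · have hφ : |t - φ t| ≤ (M + 1) * h :=
      (abs_sub_comm _ _).trans_le (ha.abs_integral_sub_le haM hh ht.1)
    calc ‖J (u t) - J (U (φ t) (w t))‖ = ‖J (U t (y t)) - J (U (φ t) (w t))‖ := by
          rw [hU.apply_neg_apply]
      _ ≤ K * |t - φ t| * ‖y t‖ + ‖J (y t) - J (w t)‖ := hJ.norm_map_apply_sub_apply_le _ _ _ _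
      _ ≤ K * ((M + 1) * h) * r + C * h := by
          gcongr
          exacts [hr t ht, (norm_sub_rev _ _).trans_le (hwy t ht)]
      _ = (K * (M + 1) * r + C) * h := by ring

theorem exists_essBoundedBy_comp_nat_mul {S T : ℝ} {α β : ℝ → ℝ} (hα : IsSplittingCoefficient S α)
    (hβ : IsSplittingCoefficient T β) :
    ∃ M : ℝ, ∀ n : ℕ, n ≠ 0 →
      EssBoundedBy M (fun t => α (n * t)) ∧ EssBoundedBy M fun t => β (n * t) := by
  obtain ⟨M, hM⟩ := hα.exists_essBoundedBy
  obtain ⟨N, hN⟩ := hβ.exists_essBoundedBy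
  exact ⟨max M N, fun n hn =>
    ⟨(hM.comp_mul_left (Nat.cast_ne_zero.2 hn)).mono (le_max_left _ _),
      (hN.comp_mul_left (Nat.cast_ne_zero.2 hn)).mono (le_max_right _ _)⟩⟩

theorem tendsto_const_div_natCast_nhdsGT_zero {T : ℝ} (hT : 0 < T) :
    Tendsto (fun n : ℕ => T / n) atTop (𝓝[>] 0) :=
  tendsto_nhdsWithin_iff.2 ⟨tendsto_const_div_atTop_nhds_zero_nat T,
    (eventually_gt_atTop 0).mono fun _ hn => div_pos hT (Nat.cast_pos.2 hn)⟩

theorem natCast_mul_div_mem_Icc {T : ℝ} (hT : 0 ≤ T) {k n : ℕ} (hkn : k ≤ n) :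
    (k * (T / n) : ℝ) ∈ Icc 0 T := by
  refine ⟨by positivity, ?_⟩
  rw [mul_div_left_comm]
  exact mul_le_of_le_one_right hT (div_le_one_of_le₀ (Nat.cast_le.2 hkn) n.cast_nonneg)

end GlobalError

end AbstractSplitting

open AbstractSplitting in
theorem theorem3p10_general {H₁ H₀ : Type*}
    [NormedAddCommGroup H₁] [InnerProductSpace ℂ H₁] [CompleteSpace H₁]
    [NormedAddCommGroup H₀] [InnerProductSpace ℂ H₀] [CompleteSpace H₀]
    (A : H₁ →ₗ.[ℂ] H₁) (hA : IsSelfAdjoint A) (B : H₁ → H₁) (hB : LocallyLipschitz B)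
    (J : H₁ →L[ℂ] H₀) (A₀ : H₀ →ₗ.[ℂ] H₀) (hdense : Dense (A₀.domain : Set H₀))
    (hsymm : A₀.IsFormalAdjoint A₀) (hdom : ∀ x : H₁, J x ∈ A₀.domain)
    (hext : ∀ x : A.domain, A₀ ⟨J (x : H₁), hdom x⟩ = J (A x))
    (hBJ : IsWeaklyLipschitzOnBounded J B) (u₀ : H₁) (T : ℝ) (hT : 0 < T)
    (hTmax : ENNReal.ofReal T < maximalTime A B u₀) (α β : ℝ → ℝ)
    (hα : IsSplittingCoefficient T α) (hβ : IsSplittingCoefficient T β) :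
    ∃ C > (0 : ℝ), ∃ n₀ : ℕ, ∀ n : ℕ, n₀ ≤ n →
      (∃ v : ℝ → H₁, IsSplitSolution A B (fun t => α (n * t)) (fun t => β (n * t)) u₀ T v) ∧
      ∀ t ∈ Icc 0 T, ‖J (exactFlow A B t u₀) -
        J (splitFlow A B (fun t => α (n * t)) (fun t => β (n * t)) t u₀)‖ ≤ C * (T / n) := by
  obtain ⟨K, hJ⟩ := exists_isWeaklyLipschitzGroup_unitaryGroup hA.dense_domain hdense hsymm hext
  obtain ⟨u, hu⟩ := exists_isMildSolution_of_lt_maximalTime hTmax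
  obtain ⟨M, hM⟩ := exists_essBoundedBy_comp_nat_mul hα hβ
  obtain ⟨C, hC, herror⟩ :=
    hu.exists_forall_eventually_norm_map_sub_le (hM 1 one_ne_zero).1.nonneg hT.le hJ hB hBJ
  obtain ⟨n₀, hn₀⟩ := Filter.eventually_atTop.1 <| (Filter.eventually_ne_atTop 0).and <|
    (tendsto_const_div_natCast_nhdsGT_zero hT).eventually herror
  refine ⟨C, hC, n₀, fun n hn => ?_⟩
  obtain ⟨hn, hsplit⟩ := hn₀ n hn
  obtain ⟨hαM, hβM⟩ := hM n hn
  obtain ⟨v, hv, herr⟩ := hsplit _ _ (hα.comp_nat_mul hn) hαM (hβ.comp_nat_mul hn) hβM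
  refine ⟨⟨v, hv⟩, fun t ht => ?_⟩
  rw [hu.exactFlow_eq hB ht, hv.splitFlow_eq hB hαM hβM ht]
  exact herr t ht

theorem theorem3p10 {H₁ H₀ : Type*}
    [NormedAddCommGroup H₁] [InnerProductSpace ℂ H₁] [CompleteSpace H₁]
    [NormedAddCommGroup H₀] [InnerProductSpace ℂ H₀] [CompleteSpace H₀]
    (A : H₁ →ₗ.[ℂ] H₁) (hA : IsSelfAdjoint A)
    (B : H₁ → H₁) (hB : LocallyLipschitz B)
    (J : H₁ →L[ℂ] H₀) (hJ : Function.Injective J)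
    (A₀ : H₀ →ₗ.[ℂ] H₀) (hA₀ : IsSelfAdjoint A₀)
    (hdom : ∀ x : H₁, J x ∈ A₀.domain)
    (hext : ∀ x : A.domain, A₀ ⟨J (x : H₁), hdom x⟩ = J (A x))
    (B' : H₁ → H₀ →L[ℝ] H₀) (hB' : AbstractSplitting.HasUniformDerivative J B B')
    (u₀ : H₁) (T : ℝ) (hT : 0 < T)
    (hTmax : ENNReal.ofReal T < AbstractSplitting.maximalTime A B u₀)
    (α β : ℝ → ℝ) (hα : AbstractSplitting.IsSplittingCoefficient T α)
    (hβ : AbstractSplitting.IsSplittingCoefficient T β) :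
    ∃ C > (0 : ℝ), ∃ n₀ : ℕ, ∀ n : ℕ, n₀ ≤ n →
      (∃ v : ℝ → H₁, AbstractSplitting.IsSplitSolution A B
        (fun t => α (n * t)) (fun t => β (n * t)) u₀ T v) ∧
      ∀ k : ℕ, k ≤ n →
        ‖J (AbstractSplitting.exactFlow A B (k * (T / n)) u₀) -
          J (AbstractSplitting.splitFlow A B
            (fun t => α (n * t)) (fun t => β (n * t)) (k * (T / n)) u₀)‖ ≤ C * (T / n) := by
  obtain ⟨C, hC, n₀, h⟩ := theorem3p10_general A hA B hB J A₀ hA₀.dense_domain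
    (AbstractSplitting.isFormalAdjoint_self_of_isSelfAdjoint hA₀) hdom hext
    hB'.isWeaklyLipschitzOnBounded u₀ T hT hTmax α β hα hβ
  exact ⟨C, hC, n₀, fun n hn => ⟨(h n hn).1, fun k hk =>
    (h n hn).2 _ (AbstractSplitting.natCast_mul_div_mem_Icc hT.le hk)⟩⟩
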